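/- Let $\mathcal H=\mathcal H_+\oplus\mathcal H_-$ be an orthogonal decomposition of a complex Hilbert space into infinite-dimensional closed subspaces, let $P_+$ be the orthogonal projection onto $\mathcal H_+$, and write $L^2(E,F)$ for the Hilbert--Schmidt operators $E\to F$ with the Hilbert--Schmidt norm $\|\cdot\|_2$. The restricted Grassmannian $\mathrm{Gr}_{\rm res}$ is the set of closed subspaces $W\subset\mathcal H$ such that the orthogonal projection $W\to\mathcal H_+$ is Fredholm and the orthogonal projection $W\to\mathcal H_-$ is Hilbert--Schmidt; a closed subspace $W$ is identified with the orthogonal projection $P_W$ onto it. $\mathrm{Gr}_{\rm res}$ carries the topology and the smooth structure given by the charts $\phi_W(V)=P_{W^\perp}(P_W|_V)^{-1}\in L^2(W,W^\perp)$, $W\in\mathrm{Gr}_{\rm res}$, defined for those $V\in\mathrm{Gr}_{\rm res}$ with $V\oplus W^\perp=\mathcal H$ (a not necessarily orthogonal direct sum). Let $U_{\rm res}$ be the group of unitary operators $g$ on $\mathcal H$ with $[g,P_+]\in L^2(\mathcal H,\mathcal H)$, with the smooth structure as a submanifold of the Banach space of bounded operators $x$ with $[x,P_+]\in L^2(\mathcal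 H,\mathcal H)$, normed by $\max(\|x\|,\|[x,P_+]\|_2)$. Let $U_+$ be the unitary group of $\mathcal H_+$, with the smooth structure as a submanifold of the bounded operators on $\mathcal H_+$ with the operator norm, and $\mathfrak u_+$ the real Banach space of bounded skew-adjoint operators on $\mathcal H_+$. Let $\mathfrak U_{\rm res}$ be the set of partial isometries $u$ on $\mathcal H$ with $u^*u,uu^*\in\mathrm{Gr}_{\rm res}$. Let $(V_\alpha,\psi_\alpha)_\alpha$, $\psi_\alpha:V_\alpha\to\mathfrak u_+$, be a smooth atlas of $U_+$. Let $(\Omega_\beta)_\beta$ be an open cover of $\mathrm{Gr}_{\rm res}$ and $W_\beta\in\Omega_\beta$ points such that $\Omega_\beta$ is contained in the domain of $\phi_{W_\beta}$; put $\tilde\psi_\beta=\phi_{W_\beta}|_{\Omega_\beta}$. Let $\sigma_\beta:\Omega_\beta\to U_{\rm res}$ be smooth maps with $V=\sigma_\beta(V)\mathcal H_+$ for all $V\in\Omega_\beta$. Define $$\Omega_{\alpha\beta\gamma}=\{u\in\mathfrak U_{\rm res}: u^*u\in\Omega_\beta,\ uu^*\in\Omega_\gamma,\ (\sigma_\gamma(uu^*)^{-1}u\,\sigma_\beta(u^*u))|_{\mathcal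 H_+}\in V_\alpha\},$$ $$\Phi_{\alpha\beta\gamma}(u)=\big(\tilde\psi_\gamma(uu^*),\ \tilde\psi_\beta(u^*u),\ \psi_\alpha\big((\sigma_\gamma(uu^*)^{-1}u\,\sigma_\beta(u^*u))|_{\mathcal H_+}\big)\big).$$ Then the maps $\Phi_{\alpha\beta\gamma}:\Omega_{\alpha\beta\gamma}\to L^2(W_\gamma,W_\gamma^\perp)\times L^2(W_\beta,W_\beta^\perp)\times\mathfrak u_+$ are well defined (that is, $\tilde\psi_\beta$ takes values in $L^2(W_\beta,W_\beta^\perp)$, and $(\sigma_\gamma(uu^*)^{-1}u\,\sigma_\beta(u^*u))|_{\mathcal H_+}\in U_+$ whenever $u^*u\in\Omega_\beta$ and $uu^*\in\Omega_\gamma$), and they form a smooth atlas on $\mathfrak U_{\rm res}$: the sets $\Omega_{\alpha\beta\gamma}$ cover $\mathfrak U_{\rm res}$, each $\Phi_{\alpha\beta\gamma}$ is injective, the images of $\Omega_{\alpha\beta\gamma}$ and of the overlaps $\Omega_{\alpha\beta\gamma}\cap\Omega_{\alpha'\beta'\gamma'}$ under $\Phi_{\alpha\beta\gamma}$ are open,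 and all transition maps are (real) smooth. The model spaces are Banach spaces and the topology defined by the atlas is Hausdorff, so $\mathfrak U_{\rm res}$ becomes a smooth (Hausdorff) Banach manifold modelled on the Banach spaces $L^2(W_\gamma,W_\gamma^\perp)\times L^2(W_\beta,W_\beta^\perp)\times\mathfrak u_+$. -/

import Mathlib

open Set Topology
open scoped ContDiff InnerProductSpace

/-! ### Smooth atlases on a set, with model Banach spaces that may depend on the chart -/

section Atlas

variable {M ι : Type*} {E : ι → Type*} [∀ i, NormedAddCommGroup (E i)] [∀ i, NormedSpace ℝ (E i)]

/-- The family of charts `φ i : dom i → E i` (only the values of `φ i` on `dom i` matter) is a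
smooth atlas on the set `M`: the domains cover `M`, every chart is injective, the images of the
overlaps (in particular the images of the charts) are open, and the transition maps
`φ j ∘ (φ i)⁻¹ : φ i (dom i ∩ dom j) → φ j (dom i ∩ dom j)` are smooth. -/
structure IsSmoothAtlas (dom : ι → Set M) (φ : ∀ i, M → E i) : Prop where
  cover : ⋃ i, dom i = univ
  injOn : ∀ i, InjOn (φ i) (dom i)
  isOpen_image : ∀ i j, IsOpen (φ i '' (dom i ∩ dom j))
  smooth_transition : ∀ i j, ∃ g : E i → E j, ContDiffOn ℝ ∞ g (φ i '' (dom i ∩ dom j)) ∧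
    ∀ x ∈ dom i ∩ dom j, g (φ i x) = φ j x

/-- The manifold topology of an atlas: it is generated by the preimages under the charts of the
open subsets of the model spaces. -/
@[reducible]
def atlasTopology (dom : ι → Set M) (φ : ∀ i, M → E i) : TopologicalSpace M :=
  TopologicalSpace.generateFrom {s | ∃ i, ∃ O : Set (E i), IsOpen O ∧ s = dom i ∩ φ i ⁻¹' O}

/-- A map `f : s → F` from a subset `s` of a manifold (with atlas `dom`, `φ`) to a normed space is
smooth if all its coordinate expressions `f ∘ (φ i)⁻¹ : φ i (s ∩ dom i) → F` are. -/
def SmoothOnAtlas (dom : ι → Set M) (φ : ∀ i, M → E i) {F : Type*} [NormedAddCommGroup F]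
    [NormedSpace ℝ F] (f : M → F) (s : Set M) : Prop :=
  ∀ i, ∃ g : E i → F, ContDiffOn ℝ ∞ g (φ i '' (s ∩ dom i)) ∧ ∀ x ∈ s ∩ dom i, g (φ i x) = f x

end Atlas

noncomputable section

/-! ### Hilbert–Schmidt operators -/

section HilbertSchmidt

variable (E F : Type*) [NormedAddCommGroup E] [InnerProductSpace ℂ E] [CompleteSpace E]
  [NormedAddCommGroup F] [InnerProductSpace ℂ F]

/-- The index set of a chosen orthonormal (Hilbert) basis of `E`. -/
def hsIndex : Set E := (exists_hilbertBasis ℂ E).choose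

/-- A chosen orthonormal (Hilbert) basis of `E`. -/
def hsBasis : HilbertBasis (hsIndex E) ℂ E := (exists_hilbertBasis ℂ E).choose_spec.choose

variable {E F}

/-- `A` is Hilbert–Schmidt: `∑ ‖A eᵢ‖² < ∞` for an orthonormal basis `(eᵢ)`. The choice of the
basis is irrelevant, see `isHilbertSchmidt_iff`. -/
def IsHilbertSchmidt (A : E →L[ℂ] F) : Prop :=
  Summable fun i => ‖A (hsBasis E i)‖ ^ 2

theorem isHilbertSchmidt_iff_memℓp (A : E →L[ℂ] F) :
    IsHilbertSchmidt A ↔ Memℓp (fun i => A (hsBasis E i)) 2 := by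
  rw [memℓp_gen_iff (by norm_num)]
  simp [IsHilbertSchmidt]

theorem HilbertBasis.tsum_enorm_inner_sq {G ι : Type*} [NormedAddCommGroup G]
    [InnerProductSpace ℂ G] (b : HilbertBasis ι ℂ G) (x : G) :
    ∑' i, ‖⟪b i, x⟫_ℂ‖ₑ ^ 2 = ‖x‖ₑ ^ 2 := by
  have h := lp.hasSum_norm (p := 2) (by norm_num) (b.repr x)
  simp only [b.repr_apply_apply, LinearIsometryEquiv.norm_map, ENNReal.toReal_ofNat,
    Real.rpow_ofNat] at h
  have h2 := ENNReal.ofReal_tsum_of_nonneg (fun i => by positivity) h.summable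
  rw [h.tsum_eq] at h2
  simpa [ENNReal.ofReal_pow, ofReal_norm] using h2.symm

theorem tsum_enorm_sq_eq_adjoint [CompleteSpace F] {ι κ : Type*} (b : HilbertBasis ι ℂ E)
    (c : HilbertBasis κ ℂ F) (A : E →L[ℂ] F) :
    ∑' i, ‖A (b i)‖ₑ ^ 2 = ∑' j, ‖ContinuousLinearMap.adjoint A (c j)‖ₑ ^ 2 := by
  have h1 : ∀ i, ‖A (b i)‖ₑ ^ 2 = ∑' j, ‖⟪c j, A (b i)⟫_ℂ‖ₑ ^ 2 :=
    fun i => (c.tsum_enorm_inner_sq _).symm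
  have h2 : ∀ j, ‖ContinuousLinearMap.adjoint A (c j)‖ₑ ^ 2 =
      ∑' i, ‖⟪b i, ContinuousLinearMap.adjoint A (c j)⟫_ℂ‖ₑ ^ 2 :=
    fun j => (b.tsum_enorm_inner_sq _).symm
  simp_rw [h1, h2]
  rw [ENNReal.tsum_comm]
  refine tsum_congr fun j => tsum_congr fun i => ?_
  rw [ContinuousLinearMap.adjoint_inner_right, ← inner_conj_symm, ← ofReal_norm, ← ofReal_norm,
    RCLike.norm_conj]

/-- `∑ ‖A eᵢ‖²` is the same for all orthonormal bases. -/
theorem tsum_enorm_sq_basis_indep [CompleteSpace F] {ι : Type*} (b : HilbertBasis ι ℂ E)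
    (A : E →L[ℂ] F) : ∑' i, ‖A (b i)‖ₑ ^ 2 = ∑' i, ‖A (hsBasis E i)‖ₑ ^ 2 := by
  rw [tsum_enorm_sq_eq_adjoint b (hsBasis F), tsum_enorm_sq_eq_adjoint (hsBasis E) (hsBasis F)]

theorem summable_norm_sq_iff {G ι : Type*} [NormedAddCommGroup G] (f : ι → G) :
    (Summable fun i => ‖f i‖ ^ 2) ↔ ∑' i, ‖f i‖ₑ ^ 2 ≠ ⊤ := by
  have h : ∀ i, ‖f i‖ₑ ^ 2 = ((‖f i‖₊ ^ 2 : NNReal) : ENNReal) := fun i => by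
    rw [ENNReal.coe_pow]; rfl
  simp_rw [h, ENNReal.tsum_coe_ne_top_iff_summable, ← NNReal.summable_coe]
  simp

theorem isHilbertSchmidt_iff [CompleteSpace F] {ι : Type*} (b : HilbertBasis ι ℂ E)
    (A : E →L[ℂ] F) : IsHilbertSchmidt A ↔ Summable fun i => ‖A (b i)‖ ^ 2 := by
  rw [IsHilbertSchmidt, summable_norm_sq_iff, summable_norm_sq_iff, tsum_enorm_sq_basis_indep b]

variable (E F)

/-- The Hilbert–Schmidt operators as a linear subspace of the bounded operators. -/
def hsSubmodule : Submodule ℂ (E →L[ℂ] F) where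
  carrier := {A | IsHilbertSchmidt A}
  add_mem' {A B} hA hB := by
    simp only [Set.mem_ofPred_eq, isHilbertSchmidt_iff_memℓp] at *
    exact hA.add hB
  zero_mem' := by simp [IsHilbertSchmidt]
  smul_mem' c A hA := by
    simp only [Set.mem_ofPred_eq, isHilbertSchmidt_iff_memℓp] at *
    exact hA.const_smul c

/-- The space `L²(E, F)` of Hilbert–Schmidt operators; it carries the Hilbert–Schmidt norm. -/
def HS : Type _ := ↥(hsSubmodule E F)

namespace HS

instance : AddCommGroup (HS E F) := inferInstanceAs (AddCommGroup ↥(hsSubmodule E F))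

instance : Module ℂ (HS E F) := inferInstanceAs (Module ℂ ↥(hsSubmodule E F))

variable {E F}

/-- The Hilbert–Schmidt operator defined by a bounded operator with the Hilbert–Schmidt
property. -/
def mk (A : E →L[ℂ] F) (hA : IsHilbertSchmidt A) : HS E F := (⟨A, hA⟩ : ↥(hsSubmodule E F))

/-- A Hilbert–Schmidt operator as a bounded operator. -/
def toCLM (A : HS E F) : E →L[ℂ] F := Subtype.val (p := (· ∈ hsSubmodule E F)) A

variable (E F)

/-- The map `A ↦ (A eᵢ)ᵢ` for the chosen orthonormal basis `(eᵢ)`. -/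
def toLp : HS E F →ₗ[ℂ] lp (fun _ : hsIndex E => F) 2 where
  toFun A := ⟨fun i => A.toCLM (hsBasis E i), (isHilbertSchmidt_iff_memℓp _).1 A.2⟩
  map_add' _ _ := rfl
  map_smul' _ _ := rfl

theorem toLp_injective : Function.Injective (toLp E F) := by
  intro A B h
  refine Subtype.ext (ContinuousLinearMap.ext_on
    ((Submodule.dense_iff_topologicalClosure_eq_top).2 (hsBasis E).dense_span) ?_)
  rintro _ ⟨i, rfl⟩
  exact congrFun (congrArg Subtype.val h) i

/-- The Hilbert–Schmidt norm `‖A‖₂ = (∑ ‖A eᵢ‖²)^(1/2)`, see `HS.norm_sq_eq`. -/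
instance : NormedAddCommGroup (HS E F) :=
  NormedAddCommGroup.induced (HS E F) (lp (fun _ : hsIndex E => F) 2) (toLp E F)
    (toLp_injective E F)

instance : NormedSpace ℂ (HS E F) :=
  NormedSpace.induced ℂ (HS E F) (lp (fun _ : hsIndex E => F) 2) (toLp E F)

theorem norm_sq_eq (A : HS E F) : ‖A‖ ^ 2 = ∑' i, ‖A.toCLM (hsBasis E i)‖ ^ 2 := by
  have h := lp.norm_rpow_eq_tsum (p := 2) (by norm_num) (toLp E F A)
  simp only [ENNReal.toReal_ofNat, Real.rpow_ofNat] at h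
  exact h

end HS

end HilbertSchmidt

/-! ### The restricted Grassmannian and the restricted unitary group -/

variable {H : Type*} [NormedAddCommGroup H] [InnerProductSpace ℂ H] [CompleteSpace H]

section Restricted

variable (Hp : Submodule ℂ H) [CompleteSpace Hp]

/-- The restricted Grassmannian of the polarization `H = Hp ⊕ Hpᗮ`: the closed (equivalently,
complete) subspaces `W` of `H` for which the orthogonal projection `W → Hp` is Fredholm and the
orthogonal projection `W → Hpᗮ` is Hilbert–Schmidt. -/
structure GrRes where
  space : Submodule ℂ H
  complete : CompleteSpace space
  fredholm : (Hp.orthogonalProjectionOnto ∘L space.subtypeL).IsFredholm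
  hilbertSchmidt : IsHilbertSchmidt (Hpᗮ.orthogonalProjectionOnto ∘L space.subtypeL)

attribute [instance] GrRes.complete

/-- The space `L_res` of bounded operators `x` on `H` with `[x, P₊]` Hilbert–Schmidt, as a linear
subspace. -/
def resSubmodule : Submodule ℂ (H →L[ℂ] H) :=
  (hsSubmodule H H).comap
    (LinearMap.mulRight ℂ Hp.starProjection - LinearMap.mulLeft ℂ Hp.starProjection)

theorem mem_resSubmodule (x : H →L[ℂ] H) : x ∈ resSubmodule Hp ↔
    IsHilbertSchmidt (x * Hp.starProjection - Hp.starProjection * x) := Iff.rfl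

/-- The space `L_res` with its own norm `max (‖x‖, ‖[x, P₊]‖₂)`. -/
def LRes : Type _ := ↥(resSubmodule Hp)

namespace LRes

instance : AddCommGroup (LRes Hp) := inferInstanceAs (AddCommGroup ↥(resSubmodule Hp))

instance : Module ℂ (LRes Hp) := inferInstanceAs (Module ℂ ↥(resSubmodule Hp))

variable {Hp}

/-- An element of `L_res` as a bounded operator. -/
def toCLM (x : LRes Hp) : H →L[ℂ] H := Subtype.val (p := (· ∈ resSubmodule Hp)) x

/-- The commutator `[x, P₊]` as a Hilbert–Schmidt operator. -/
def comm (x : LRes Hp) : HS H H :=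
  HS.mk (x.toCLM * Hp.starProjection - Hp.starProjection * x.toCLM) x.2

variable (Hp)

/-- The map `x ↦ (x, [x, P₊])`. -/
def toProd : LRes Hp →ₗ[ℂ] (H →L[ℂ] H) × HS H H where
  toFun x := (x.toCLM, x.comm)
  map_add' x y := Prod.ext rfl (Subtype.ext
    (map_add (LinearMap.mulRight ℂ Hp.starProjection - LinearMap.mulLeft ℂ Hp.starProjection)
      x.toCLM y.toCLM))
  map_smul' c x := Prod.ext rfl (Subtype.ext
    (map_smul (LinearMap.mulRight ℂ Hp.starProjection - LinearMap.mulLeft ℂ Hp.starProjection)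
      c x.toCLM))

theorem toProd_injective : Function.Injective (toProd Hp) :=
  fun _ _ h => Subtype.ext (congrArg Prod.fst h)

instance : NormedAddCommGroup (LRes Hp) :=
  NormedAddCommGroup.induced (LRes Hp) ((H →L[ℂ] H) × HS H H) (toProd Hp) (toProd_injective Hp)

instance : NormedSpace ℂ (LRes Hp) :=
  NormedSpace.induced ℂ (LRes Hp) ((H →L[ℂ] H) × HS H H) (toProd Hp)

end LRes

/-- The restricted unitary group: the unitary operators `u` on `H` with `[u, P₊]` Hilbert–Schmidt.
As a Banach Lie group it is a submanifold of the Banach space `L_res`. -/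
def URes : Type _ := {x : LRes Hp // x.toCLM ∈ unitary (H →L[ℂ] H)}

namespace URes

variable {Hp}

/-- An element of `U_res` as an element of `L_res`. -/
def toLRes (g : URes Hp) : LRes Hp := g.1

/-- An element of `U_res` as a unitary operator on `H`. -/
def toUnitary (g : URes Hp) : unitary (H →L[ℂ] H) := ⟨g.1.toCLM, g.2⟩

end URes

/-- The partial isometries `u` on `H` with `u* u` and `u u*` in the restricted Grassmannian (whose
elements are identified with the orthogonal projections onto them). -/
def PartIsoRes : Type _ :=
  {u : H →L[ℂ] H // IsStarProjection (star u * u) ∧ IsStarProjection (u * star u) ∧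
    (∃ W : GrRes Hp, W.space.starProjection = star u * u) ∧
    (∃ W : GrRes Hp, W.space.starProjection = u * star u)}

variable {Hp}

namespace PartIsoRes

/-- The source `u* u`, as an element of the restricted Grassmannian. -/
def source (u : PartIsoRes Hp) : GrRes Hp := u.2.2.2.1.choose

/-- The target `u u*`, as an element of the restricted Grassmannian. -/
def target (u : PartIsoRes Hp) : GrRes Hp := u.2.2.2.2.choose

theorem starProjection_source (u : PartIsoRes Hp) :
    u.source.space.starProjection = star u.1 * u.1 := u.2.2.2.1.choose_spec

theorem starProjection_target (u : PartIsoRes Hp) :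
    u.target.space.starProjection = u.1 * star u.1 := u.2.2.2.2.choose_spec

end PartIsoRes

/-! ### Charts of the restricted Grassmannian -/

/-- The domain of the chart at `W`: all `V` with `V ⊕ Wᗮ = H` (not necessarily orthogonally). -/
def grDom (W : GrRes Hp) : Set (GrRes Hp) := {V | IsCompl V.space W.spaceᗮ}

/-- The operator `P_{Wᗮ} (P_W|_V)⁻¹ : W → Wᗮ`. For `V` in `grDom W` its graph is `V`. -/
def grChartOp (W V : GrRes Hp) : W.space →L[ℂ] W.spaceᗮ :=
  (W.spaceᗮ.orthogonalProjectionOnto ∘L V.space.subtypeL) ∘L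
    (W.space.orthogonalProjectionOnto ∘L V.space.subtypeL).inverse

open Classical in
/-- The chart at `W`, with values in `L²(W, Wᗮ)` (on `grDom W` the operator is always
Hilbert–Schmidt; outside of it the value is irrelevant). -/
def grChart (W V : GrRes Hp) : HS W.space W.spaceᗮ :=
  if h : IsHilbertSchmidt (grChartOp W V) then HS.mk (grChartOp W V) h else 0

variable (Hp) in
/-- The manifold topology of the restricted Grassmannian. -/
@[reducible]
def grTopology : TopologicalSpace (GrRes Hp) :=
  atlasTopology (E := fun W : GrRes Hp => HS W.space W.spaceᗮ) grDom grChart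

/-- `σ` is a smooth local cross-section over `Ω`: a smooth map `Ω → U_res` such that
`V = σ(V) Hp` for `V` in `Ω`. -/
structure IsSmoothCrossSection (Ω : Set (GrRes Hp)) (σ : GrRes Hp → URes Hp) : Prop where
  smooth : SmoothOnAtlas (E := fun W : GrRes Hp => HS W.space W.spaceᗮ) grDom grChart
    (fun V => (σ V).toLRes) Ω
  map_eq : ∀ V ∈ Ω, Hp.map ((σ V).toLRes.toCLM : H →ₗ[ℂ] H) = V.space

end Restricted

/-! ### Charts of the unitary group -/

section UnitaryGroup

variable (K : Type*) [NormedAddCommGroup K] [InnerProductSpace ℂ K] [CompleteSpace K]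

/-- The unitary group of the Hilbert space `K`, with the norm topology. -/
abbrev UGroup : Type _ := ↥(unitary (K →L[ℂ] K))

/-- The real Banach space of skew-adjoint bounded operators on `K`. -/
abbrev UAlg : Type _ := ↥(skewAdjoint.submodule ℝ (K →L[ℂ] K))

variable {K}

/-- A smooth chart of the unitary group, a closed submanifold of the real Banach space of bounded
operators: a homeomorphism `e` from an open set of unitaries onto an open set of skew-adjoint
operators, such that `e⁻¹` is smooth as an operator-valued map and `e` is locally the restriction
of a smooth map defined on an open set of operators. -/
structure IsSmoothUnitaryChart (e : OpenPartialHomeomorph (UGroup K) (UAlg K)) : Prop where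
  smooth_symm : ContDiffOn ℝ ∞ (fun X => (e.symm X : K →L[ℂ] K)) e.target
  smooth : ∀ g ∈ e.source, ∃ N : Set (K →L[ℂ] K), IsOpen N ∧ (g : K →L[ℂ] K) ∈ N ∧
    ∃ f : (K →L[ℂ] K) → UAlg K, ContDiffOn ℝ ∞ f N ∧
      ∀ g' ∈ e.source, (g' : K →L[ℂ] K) ∈ N → f g' = e g'

end UnitaryGroup

/-! ### The charts of the groupoid of partial isometries -/

section Charts

variable {Hp : Submodule ℂ H} [CompleteSpace Hp]

/-- The operator `(σ_γ(u u*)⁻¹ u σ_β(u* u))|_{Hp}` on `Hp`. -/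
def transportOp (σγ σβ : GrRes Hp → URes Hp) (u : PartIsoRes Hp) : Hp →L[ℂ] Hp :=
  Hp.orthogonalProjectionOnto ∘L
    ((((σγ u.target).toUnitary⁻¹ : unitary (H →L[ℂ] H)) : H →L[ℂ] H) * u.1 *
      ((σβ u.source).toUnitary : H →L[ℂ] H)) ∘L Hp.subtypeL

open Classical in
/-- `transportOp` as an element of the unitary group of `Hp` (it is unitary whenever the sections
are cross-sections near the target and the source of `u`; otherwise the value is irrelevant). -/
def transport (σγ σβ : GrRes Hp → URes Hp) (u : PartIsoRes Hp) : UGroup Hp :=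
  if h : transportOp σγ σβ u ∈ unitary (Hp →L[ℂ] Hp) then ⟨transportOp σγ σβ u, h⟩ else 1

variable {I J : Type*} (ψ : I → OpenPartialHomeomorph (UGroup Hp) (UAlg Hp)) (W : J → GrRes Hp)
  (Ω : J → Set (GrRes Hp)) (σ : J → GrRes Hp → URes Hp)

/-- The model space `L²(W_γ, W_γᗮ) × L²(W_β, W_βᗮ) × 𝔲₊`. -/
abbrev resModel (β γ : J) : Type _ :=
  HS (W γ).space (W γ).spaceᗮ × HS (W β).space (W β).spaceᗮ × UAlg Hp

/-- The chart domain `Ω_{αβγ}`, for the index `i = (α, β, γ)`. -/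
def resDom (i : I × J × J) : Set (PartIsoRes Hp) :=
  {u | u.source ∈ Ω i.2.1 ∧ u.target ∈ Ω i.2.2 ∧
    transportOp (σ i.2.2) (σ i.2.1) u ∈ unitary (Hp →L[ℂ] Hp) ∧
    transport (σ i.2.2) (σ i.2.1) u ∈ (ψ i.1).source}

/-- The chart `Φ_{αβγ}`, for the index `i = (α, β, γ)`. -/
def resChart (i : I × J × J) (u : PartIsoRes Hp) : resModel W i.2.1 i.2.2 :=
  (grChart (W i.2.2) u.target, grChart (W i.2.1) u.source,
    ψ i.1 (transport (σ i.2.2) (σ i.2.1) u))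

end Charts

end

/-
A partial isometry `u` with source `V = u*u` and target `V' = uu*` in the restricted Grassmannian
is determined by `V'`, `V` and the unitary `T = (σ_γ(V')⁻¹ u σ_β(V))|_{Hp}`, because
`u = σ_γ(V') T P₊ σ_β(V)*`, and every triple `(V', V, T)` arises in this way. A change of
coordinates therefore consists of two coordinate changes of the Grassmannian and of a map that
multiplies values of the smooth sections `σ` and compresses the product to `Hp`.

On the Grassmannian, the coordinate at `W'` of the graph of `A : W → Wᗮ` is a quotient of two
functions affine in `A`. It is Hilbert–Schmidt because a Fredholm operator has a right inverse
modulo operators of finite rank. The graph of every Hilbert–Schmidt `A` lies in the Grassmannian,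
because `A` is a norm limit of finite rank operators and so does not affect the Fredholm property.

The manifold is Hausdorff because its inclusion into the bounded operators is injective and smooth
in the coordinates, hence continuous.
-/

noncomputable section

/-! ### Hilbert–Schmidt operators -/

section HilbertSchmidtTheory

variable {E F G : Type*} [NormedAddCommGroup E] [InnerProductSpace ℂ E] [CompleteSpace E]
  [NormedAddCommGroup F] [InnerProductSpace ℂ F] [NormedAddCommGroup G] [InnerProductSpace ℂ G]

/-- The square `∑ ‖A eᵢ‖²` of the Hilbert–Schmidt norm, with value `⊤` when `A` is not
Hilbert–Schmidt. -/
def hsSum (A : E →L[ℂ] F) : ENNReal := ∑' i, ‖A (hsBasis E i)‖ₑ ^ 2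

theorem isHilbertSchmidt_iff_hsSum_ne_top (A : E →L[ℂ] F) : IsHilbertSchmidt A ↔ hsSum A ≠ ⊤ :=
  summable_norm_sq_iff _

theorem hsSum_adjoint [CompleteSpace F] (A : E →L[ℂ] F) :
    hsSum (ContinuousLinearMap.adjoint A) = hsSum A :=
  (tsum_enorm_sq_eq_adjoint (hsBasis E) (hsBasis F) A).symm

theorem hsSum_comp_le_left (B : F →L[ℂ] G) (A : E →L[ℂ] F) :
    hsSum (B ∘L A) ≤ ‖B‖ₑ ^ 2 * hsSum A := by
  rw [hsSum, hsSum, ← ENNReal.tsum_mul_left]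
  refine ENNReal.tsum_le_tsum fun i => ?_
  rw [← mul_pow]
  exact pow_le_pow_left' (B.le_opENorm _) 2

theorem hsSum_comp_le_right [CompleteSpace F] [CompleteSpace G] (A : F →L[ℂ] G)
    (B : E →L[ℂ] F) : hsSum (A ∘L B) ≤ ‖B‖ₑ ^ 2 * hsSum A := by
  rw [← hsSum_adjoint, ContinuousLinearMap.adjoint_comp, ← hsSum_adjoint A,
    ← LinearIsometryEquiv.enorm_map ContinuousLinearMap.adjoint B]
  exact hsSum_comp_le_left _ _

theorem enorm_adjoint_apply_sq_le [CompleteSpace F] (A : E →L[ℂ] F) (y : F) :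
    ‖ContinuousLinearMap.adjoint A y‖ₑ ^ 2 ≤ hsSum A * ‖y‖ₑ ^ 2 := by
  rw [← (hsBasis E).tsum_enorm_inner_sq, hsSum, ← ENNReal.tsum_mul_right]
  refine ENNReal.tsum_le_tsum fun i => ?_
  rw [ContinuousLinearMap.adjoint_inner_right, ← mul_pow]
  have cauchy_schwarz : ‖⟪A (hsBasis E i), y⟫_ℂ‖ₑ ≤ ‖A (hsBasis E i)‖ₑ * ‖y‖ₑ := by
    simpa only [enorm, ← ENNReal.coe_mul, ENNReal.coe_le_coe] using nnnorm_inner_le_nnnorm _ _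
  exact pow_le_pow_left' cauchy_schwarz 2

namespace IsHilbertSchmidt

theorem clm_comp {A : E →L[ℂ] F} (hA : IsHilbertSchmidt A) (B : F →L[ℂ] G) :
    IsHilbertSchmidt (B ∘L A) := by
  rw [isHilbertSchmidt_iff_hsSum_ne_top] at *
  exact ne_top_of_le_ne_top (ENNReal.mul_ne_top (by simp) hA) (hsSum_comp_le_left B A)

theorem comp_clm [CompleteSpace F] [CompleteSpace G] {A : F →L[ℂ] G}
    (hA : IsHilbertSchmidt A) (B : E →L[ℂ] F) : IsHilbertSchmidt (A ∘L B) := by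
  rw [isHilbertSchmidt_iff_hsSum_ne_top] at *
  exact ne_top_of_le_ne_top (ENNReal.mul_ne_top (by simp) hA) (hsSum_comp_le_right A B)

theorem add {A B : E →L[ℂ] F} (hA : IsHilbertSchmidt A) (hB : IsHilbertSchmidt B) :
    IsHilbertSchmidt (A + B) :=
  (hsSubmodule E F).add_mem hA hB

theorem sub {A B : E →L[ℂ] F} (hA : IsHilbertSchmidt A) (hB : IsHilbertSchmidt B) :
    IsHilbertSchmidt (A - B) :=
  (hsSubmodule E F).sub_mem hA hB

theorem neg {A : E →L[ℂ] F} (hA : IsHilbertSchmidt A) : IsHilbertSchmidt (-A) :=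
  (hsSubmodule E F).neg_mem hA

end IsHilbertSchmidt

theorem isHilbertSchmidt_of_finiteDimensional [FiniteDimensional ℂ E] (A : E →L[ℂ] F) :
    IsHilbertSchmidt A :=
  have : Finite (hsIndex E) := (hsBasis E).orthonormal.linearIndependent.finite
  Summable.of_finite

theorem isHilbertSchmidt_of_hasFiniteRange {A : E →L[ℂ] F} (hA : A.HasFiniteRange) :
    IsHilbertSchmidt A :=
  have : FiniteDimensional ℂ A.range := .of_fg hA.fg_range
  have : CompleteSpace A.range := FiniteDimensional.complete ℂ _
  ((isHilbertSchmidt_of_finiteDimensional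
    (ContinuousLinearMap.id ℂ A.range)).comp_clm A.rangeRestrict).clm_comp A.range.subtypeL

namespace HS

@[simp] theorem toCLM_mk (A : E →L[ℂ] F) (hA : IsHilbertSchmidt A) : (mk A hA).toCLM = A := rfl

@[ext] theorem ext {A B : HS E F} (h : A.toCLM = B.toCLM) : A = B := Subtype.ext h

theorem isHilbertSchmidt (A : HS E F) : IsHilbertSchmidt A.toCLM := A.2

theorem enorm_sq_eq (A : HS E F) : ‖A‖ₑ ^ 2 = hsSum A.toCLM := by
  rw [← ofReal_norm, ← ENNReal.ofReal_pow (norm_nonneg _), norm_sq_eq,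
    ENNReal.ofReal_tsum_of_nonneg (fun i => by positivity) A.isHilbertSchmidt, hsSum]
  simp [ENNReal.ofReal_pow, ofReal_norm]

theorem norm_toCLM_le [CompleteSpace F] (A : HS E F) : ‖A.toCLM‖ ≤ ‖A‖ := by
  rw [← LinearIsometryEquiv.norm_map ContinuousLinearMap.adjoint A.toCLM, ← enorm_le_iff_norm_le]
  refine ContinuousLinearMap.opENorm_le_bound _ fun y => ?_
  rw [← ENNReal.pow_le_pow_left_iff two_ne_zero, mul_pow, enorm_sq_eq]
  exact enorm_adjoint_apply_sq_le A.toCLM y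

variable (E F) in
/-- The inclusion of the Hilbert–Schmidt operators into the bounded operators. -/
def toCLML [CompleteSpace F] : HS E F →L[ℂ] E →L[ℂ] F :=
  LinearMap.mkContinuous ⟨⟨toCLM, fun _ _ => rfl⟩, fun _ _ => rfl⟩ 1
    fun A => A.norm_toCLM_le.trans_eq (one_mul _).symm

theorem norm_le_mul_of_hsSum_le {E' F' B : Type*} [NormedAddCommGroup E']
    [InnerProductSpace ℂ E'] [CompleteSpace E'] [NormedAddCommGroup F'] [InnerProductSpace ℂ F']
    [NormedAddCommGroup B] {A : HS E F} {A' : HS E' F'} {b : B}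
    (h : hsSum A.toCLM ≤ ‖b‖ₑ ^ 2 * hsSum A'.toCLM) : ‖A‖ ≤ ‖b‖ * ‖A'‖ := by
  rw [← enorm_sq_eq, ← enorm_sq_eq, ← mul_pow, ENNReal.pow_le_pow_left_iff two_ne_zero] at h
  simpa [← ofReal_norm, ← ENNReal.ofReal_mul, ENNReal.ofReal_le_ofReal_iff, mul_nonneg] using h

/-- The map `A ↦ B A` on Hilbert–Schmidt operators, for a bounded operator `B`. -/
def clmComp (B : F →L[ℂ] G) : HS E F →L[ℂ] HS E G :=
  LinearMap.mkContinuous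
    ⟨⟨fun A => mk (B ∘L A.toCLM) (A.isHilbertSchmidt.clm_comp B),
      fun A A' => HS.ext (ContinuousLinearMap.comp_add B A.toCLM A'.toCLM)⟩,
      fun c A => HS.ext (ContinuousLinearMap.comp_smul B c A.toCLM)⟩ ‖B‖
    fun A => norm_le_mul_of_hsSum_le (hsSum_comp_le_left B A.toCLM)

variable (E F G) in
/-- The composition `(A, B) ↦ A B` of a Hilbert–Schmidt operator and a bounded operator, as a
continuous bilinear map into the Hilbert–Schmidt operators. -/
def compCLM [CompleteSpace F] [CompleteSpace G] : HS F G →L[ℂ] (E →L[ℂ] F) →L[ℂ] HS E G :=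
  LinearMap.mkContinuous₂
    (LinearMap.mk₂ ℂ (fun A B => mk (A.toCLM ∘L B) (A.isHilbertSchmidt.comp_clm B))
      (fun A A' B => HS.ext (ContinuousLinearMap.add_comp A.toCLM A'.toCLM B))
      (fun c A B => HS.ext (ContinuousLinearMap.smul_comp c A.toCLM B))
      (fun A B B' => HS.ext (ContinuousLinearMap.comp_add A.toCLM B B'))
      (fun c A B => HS.ext (ContinuousLinearMap.comp_smul A.toCLM c B))) 1
    fun A B => by
      rw [one_mul, mul_comm]
      exact norm_le_mul_of_hsSum_le (hsSum_comp_le_right A.toCLM B)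

@[simp] theorem toCLM_compCLM [CompleteSpace F] [CompleteSpace G] (A : HS F G) (B : E →L[ℂ] F) :
    (compCLM E F G A B).toCLM = A.toCLM ∘L B := rfl

theorem isometry_toLp : Isometry (toLp E F) :=
  AddMonoidHomClass.isometry_of_norm (toLp E F) fun _ => rfl

theorem isClosed_range_toLp [CompleteSpace F] : IsClosed (range (toLp E F)) := by
  refine IsSeqClosed.isClosed fun f y hf hy => ?_
  choose A hA using hf
  obtain rfl : (fun n => toLp E F (A n)) = f := funext hA
  have hA_cauchy : CauchySeq A :=
    isometry_toLp.isUniformInducing.cauchy_map_iff.1 hy.cauchySeq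
  obtain ⟨B, hB⟩ := cauchySeq_tendsto_of_complete
    ((toCLML E F).uniformContinuous.comp_cauchySeq hA_cauchy)
  have hBy : ∀ i, B (hsBasis E i) = y i := fun i => tendsto_nhds_unique
    (((ContinuousLinearMap.apply ℂ F (hsBasis E i)).continuous.tendsto B).comp hB)
    (((lp.evalCLM ℂ (fun _ : hsIndex E => F) 2 i).continuous.tendsto y).comp hy)
  have hBHS : IsHilbertSchmidt B := by
    rw [isHilbertSchmidt_iff_memℓp, funext hBy]
    exact y.2
  exact ⟨mk B hBHS, Subtype.ext (funext hBy)⟩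

instance [CompleteSpace F] : CompleteSpace (HS E F) :=
  (completeSpace_iff_isComplete_range isometry_toLp.isUniformInducing).2
    isClosed_range_toLp.isComplete

end HS

theorem hasFiniteRange_rankOne {𝕜 E F : Type*} [RCLike 𝕜] [NormedAddCommGroup E]
    [InnerProductSpace 𝕜 E] [NormedAddCommGroup F] [InnerProductSpace 𝕜 F] (x : E) (y : F) :
    (InnerProductSpace.rankOne 𝕜 x y).HasFiniteRange := by
  rw [InnerProductSpace.rankOne_def', ContinuousLinearMap.toLinearMap_comp]
  exact LinearMap.HasFiniteRange.of_finite_dom.comp_right _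

theorem HS.hasSum_rankOne [CompleteSpace F] (A : HS E F) :
    HasSum (fun i => InnerProductSpace.rankOne ℂ (A.toCLM (hsBasis E i)) (hsBasis E i))
      A.toCLM := by
  classical
  let R (i : hsIndex E) : HS E F := mk _ (isHilbertSchmidt_of_hasFiniteRange
    (hasFiniteRange_rankOne (A.toCLM (hsBasis E i)) (hsBasis E i)))
  have hR (i) : toLp E F (R i) = lp.single (E := fun _ => F) 2 i (toLp E F A i) := by
    refine Subtype.ext (funext fun j => ?_)
    change ⟪hsBasis E i, hsBasis E j⟫_ℂ • A.toCLM (hsBasis E i) = _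
    rw [orthonormal_iff_ite.1 (hsBasis E).orthonormal, lp.single_apply, ite_smul, one_smul,
      zero_smul]
    obtain rfl | hij := eq_or_ne i j
    · rw [if_pos rfl, Pi.single_eq_same]; rfl
    · rw [if_neg hij, Pi.single_eq_of_ne hij.symm]
  have hsum : HasSum R A := by
    rw [← isometry_toLp.isUniformInducing.isInducing.hasSum_iff]
    simpa only [Function.comp_def, hR] using lp.hasSum_single (by simp) (toLp E F A)
  exact hsum.mapL (toCLML E F)

theorem IsHilbertSchmidt.mem_closure_hasFiniteRange [CompleteSpace F] {A : E →L[ℂ] F}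
    (hA : IsHilbertSchmidt A) : A ∈ closure {B : E →L[ℂ] F | B.HasFiniteRange} :=
  mem_closure_of_tendsto (HS.hasSum_rankOne (HS.mk A hA)) <| .of_forall fun s => by
    simp only [← LinearMap.mem_finiteRange_iff_hasFiniteRange, mem_ofPred_eq,
      ContinuousLinearMap.toLinearMap_sum]
    exact Submodule.sum_mem _ fun i _ =>
      LinearMap.mem_finiteRange_iff_hasFiniteRange.2 (hasFiniteRange_rankOne _ _)

end HilbertSchmidtTheory

/-! ### Perturbations of Fredholm operators -/

section Fredholm

open LinearMap.FiniteRangeSetoid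

variable {𝕜 E F G : Type*} [NontriviallyNormedField 𝕜] [CompleteSpace 𝕜]
  [NormedAddCommGroup E] [NormedSpace 𝕜 E] [NormedAddCommGroup F] [NormedSpace 𝕜 F]
  [NormedAddCommGroup G] [NormedSpace 𝕜 G]

theorem isFredholm_of_leftQuasiInverse_of_rightQuasiInverse {T : E →L[𝕜] F} {L R : F →L[𝕜] E}
    (hL : L.IsLeftQuasiInverse T) (hR : R.IsRightQuasiInverse T) : T.IsFredholm := by
  refine .of_isQuasiInverse (v := R) ⟨?_, hR⟩
  have hRL : R.toLinearMap ≈ L.toLinearMap :=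
    calc R.toLinearMap
      _ ≈ (L.toLinearMap ∘ₗ T.toLinearMap) ∘ₗ R.toLinearMap :=
        equiv_comp_right (v := LinearMap.id) (Setoid.symm hL.equiv)
      _ ≈ L.toLinearMap := equiv_comp_left (v := LinearMap.id) hR.equiv
  exact hL.congr hRL (Setoid.refl _)

theorem isFredholm_add_of_hasFiniteRange {T K : E →L[𝕜] F} (hT : T.IsFredholm)
    (hK : K.HasFiniteRange) : (T + K).IsFredholm := by
  obtain ⟨S, hS⟩ := hT.exists_isQuasiInverse
  have h : ((T + K : E →L[𝕜] F) : E →ₗ[𝕜] F) ≈ T := by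
    rwa [equiv_iff_hasFiniteRange, ContinuousLinearMap.toLinearMap_add, add_sub_cancel_left]
  exact .of_isQuasiInverse (hS.congr (Setoid.refl _) h)

theorem isFredholm_comp_equiv {T : F →L[𝕜] G} (hT : T.IsFredholm) (e : E ≃L[𝕜] F) :
    (T ∘L (e : E →L[𝕜] F)).IsFredholm :=
  have ⟨_, hS⟩ := hT.exists_isQuasiInverse
  .of_isQuasiInverse (v := (e.symm : F →L[𝕜] E) ∘L _) (e.toLinearEquiv.isQuasiInverse.comp hS)

theorem isFredholm_add_of_norm_lt [CompleteSpace E] [CompleteSpace F] {T N : E →L[𝕜] F}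
    {S : F →L[𝕜] E} (hS : S.IsQuasiInverse T) (h : ‖S‖ * ‖N‖ < 1) : (T + N).IsFredholm := by
  let D : (E →L[𝕜] E)ˣ := Units.oneSub (-(S ∘L N)) <| by
    grw [norm_neg, ContinuousLinearMap.opNorm_comp_le]; exact h
  let D' : (F →L[𝕜] F)ˣ := Units.oneSub (-(N ∘L S)) <| by
    grw [norm_neg, ContinuousLinearMap.opNorm_comp_le, mul_comm]; exact h
  have hD : (S ∘L (T + N) : E →L[𝕜] E).toLinearMap ≈ D.1.toLinearMap := by
    have h_sub : (S ∘L (T + N) : E →L[𝕜] E).toLinearMap - D.1.toLinearMap =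
        S.toLinearMap ∘ₗ T.toLinearMap - .id := by ext; simp [D]
    rw [equiv_iff_hasNoetherianRange, h_sub, ← equiv_iff_hasNoetherianRange]
    exact hS.1
  have hD' : ((T + N) ∘L S : F →L[𝕜] F).toLinearMap ≈ D'.1.toLinearMap := by
    have h_sub : ((T + N) ∘L S : F →L[𝕜] F).toLinearMap - D'.1.toLinearMap =
        T.toLinearMap ∘ₗ S.toLinearMap - .id := by ext; simp [D']
    rw [equiv_iff_hasNoetherianRange, h_sub, ← equiv_iff_hasNoetherianRange]
    exact hS.2
  have hD_inv : D⁻¹.1.toLinearMap ∘ₗ D.1.toLinearMap = .id :=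
    congrArg ContinuousLinearMap.toLinearMap D.inv_mul
  have hD'_inv : D'.1.toLinearMap ∘ₗ D'⁻¹.1.toLinearMap = .id :=
    congrArg ContinuousLinearMap.toLinearMap D'.mul_inv
  refine isFredholm_of_leftQuasiInverse_of_rightQuasiInverse (L := D⁻¹.1 ∘L S) (R := S ∘L D'⁻¹.1)
    ?_ ?_
  · exact Setoid.trans (equiv_comp_left (u' := D⁻¹.1.toLinearMap) hD) (hD_inv ▸ Setoid.refl _)
  · exact Setoid.trans (equiv_comp_right (u := D'⁻¹.1.toLinearMap) hD') (hD'_inv ▸ Setoid.refl _)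

theorem isFredholm_add_of_mem_closure_hasFiniteRange [CompleteSpace E] [CompleteSpace F]
    {T K : E →L[𝕜] F} (hT : T.IsFredholm)
    (hK : K ∈ closure {B : E →L[𝕜] F | B.HasFiniteRange}) : (T + K).IsFredholm := by
  obtain ⟨S, hS⟩ := hT.exists_isQuasiInverse
  obtain ⟨B, hB, hKB⟩ := Metric.mem_closure_iff.1 hK (‖S‖ + 1)⁻¹ (by positivity)
  have hlt : ‖S‖ * ‖K - B‖ < 1 := by
    rw [dist_eq_norm] at hKB
    calc ‖S‖ * ‖K - B‖ ≤ ‖S‖ * (‖S‖ + 1)⁻¹ := by gcongr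
      _ < 1 := by rw [← div_eq_mul_inv, div_lt_one (by positivity)]; linarith
  have h := isFredholm_add_of_hasFiniteRange (isFredholm_add_of_norm_lt hS hlt) hB
  rwa [add_assoc, sub_add_cancel] at h

end Fredholm

/-! ### Smooth functions of coordinates -/

section FactorsSmoothly

variable {M N E F G A : Type*} [NormedAddCommGroup E] [NormedSpace ℝ E] [NormedAddCommGroup F]
  [NormedSpace ℝ F] [NormedAddCommGroup G] [NormedSpace ℝ G] [NormedRing A] [NormedAlgebra ℝ A]

/-- On `s`, the map `f` is a smooth function of the coordinates `φ`. Smoothness on an atlas and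
smoothness of the transition maps are instances of this notion, and unlike them it composes. -/
def FactorsSmoothly (φ : M → E) (f : M → F) (s : Set M) : Prop :=
  ∃ g : E → F, ContDiffOn ℝ ∞ g (φ '' s) ∧ ∀ x ∈ s, g (φ x) = f x

namespace FactorsSmoothly

variable {φ : M → E} {f f' : M → F} {h : M → G} {s t : Set M}

theorem of_contDiffOn {g : E → F} (hg : ContDiffOn ℝ ∞ g (φ '' s)) :
    FactorsSmoothly φ (g ∘ φ) s :=
  ⟨g, hg, fun _ _ => rfl⟩

theorem mono (hf : FactorsSmoothly φ f t) (hst : s ⊆ t) : FactorsSmoothly φ f s :=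
  let ⟨g, hg, hgf⟩ := hf
  ⟨g, hg.mono (image_mono hst), fun x hx => hgf x (hst hx)⟩

theorem congr (hf : FactorsSmoothly φ f s) (hff' : EqOn f f' s) : FactorsSmoothly φ f' s :=
  let ⟨g, hg, hgf⟩ := hf
  ⟨g, hg, fun x hx => (hgf x hx).trans (hff' hx)⟩

theorem trans (hf : FactorsSmoothly φ f s) (hh : FactorsSmoothly f h s) :
    FactorsSmoothly φ h s := by
  obtain ⟨g, hg, hgf⟩ := hf
  obtain ⟨k, hk, hkh⟩ := hh
  refine ⟨k ∘ g, hk.comp hg ?_, fun x hx => (congrArg k (hgf x hx)).trans (hkh x hx)⟩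
  rintro _ ⟨x, hx, rfl⟩
  exact ⟨x, hx, (hgf x hx).symm⟩

theorem contDiff_comp (hf : FactorsSmoothly φ f s) {g : F → G} (hg : ContDiff ℝ ∞ g) :
    FactorsSmoothly φ (g ∘ f) s :=
  hf.trans (of_contDiffOn hg.contDiffOn)

theorem comp_mapsTo (hf : FactorsSmoothly φ f s) {p : N → M} {r : Set N} (hp : MapsTo p r s) :
    FactorsSmoothly (φ ∘ p) (f ∘ p) r := by
  obtain ⟨g, hg, hgf⟩ := hf
  refine ⟨g, hg.mono ?_, fun x hx => hgf _ (hp hx)⟩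
  rw [image_comp]
  exact image_mono hp.image_subset

theorem prodMk (hf : FactorsSmoothly φ f s) (hh : FactorsSmoothly φ h s) :
    FactorsSmoothly φ (fun x => (f x, h x)) s :=
  let ⟨g, hg, hgf⟩ := hf
  let ⟨k, hk, hkh⟩ := hh
  ⟨fun y => (g y, k y), hg.prodMk hk, fun x hx => Prod.ext (hgf x hx) (hkh x hx)⟩

theorem mul {a b : M → A} (ha : FactorsSmoothly φ a s) (hb : FactorsSmoothly φ b s) :
    FactorsSmoothly φ (fun x => a x * b x) s :=
  (ha.prodMk hb).contDiff_comp contDiff_mul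

theorem isOpen_image_inter_preimage (hf : FactorsSmoothly φ f s) (hs : IsOpen (φ '' s))
    {O : Set F} (hO : IsOpen O) : IsOpen (φ '' (s ∩ f ⁻¹' O)) := by
  obtain ⟨g, hg, hgf⟩ := hf
  have himage : φ '' (s ∩ f ⁻¹' O) = φ '' s ∩ g ⁻¹' O := by
    rw [← image_inter_preimage]
    refine congrArg (φ '' ·) (ext fun x => and_congr_right fun hx => ?_)
    simp only [mem_preimage, hgf x hx]
  rw [himage]
  exact hg.continuousOn.isOpen_inter_preimage hs hO

end FactorsSmoothly

end FactorsSmoothly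

section AtlasTopology

variable {M ι : Type*} {E : ι → Type*} [∀ i, NormedAddCommGroup (E i)] [∀ i, NormedSpace ℝ (E i)]
  {dom : ι → Set M} {φ : ∀ i, M → E i}

theorem IsSmoothAtlas.isOpen_image_inter (h : IsSmoothAtlas dom φ) {s : Set M}
    (hs : IsOpen[atlasTopology dom φ] s) (i : ι) : IsOpen (φ i '' (dom i ∩ s)) := by
  change TopologicalSpace.GenerateOpen _ s at hs
  induction hs with
  | basic s hs =>
    obtain ⟨j, O, hO, rfl⟩ := hs
    rw [← inter_assoc]
    exact FactorsSmoothly.isOpen_image_inter_preimage (h.smooth_transition i j)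
      (h.isOpen_image i j) hO
  | univ =>
    rw [inter_univ, ← inter_self (dom i)]
    exact h.isOpen_image i i
  | inter s t _ _ hs ht =>
    rw [inter_inter_distrib_left,
      ((h.injOn i).image_inter inter_subset_left inter_subset_left)]
    exact hs.inter ht
  | sUnion S _ hS =>
    rw [sUnion_eq_biUnion, inter_iUnion₂, image_iUnion₂]
    exact isOpen_biUnion hS

theorem IsSmoothAtlas.isOpen_iff (h : IsSmoothAtlas dom φ) {s : Set M} :
    IsOpen[atlasTopology dom φ] s ↔ ∀ i, IsOpen (φ i '' (dom i ∩ s)) := by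
  refine ⟨h.isOpen_image_inter, fun hs => ?_⟩
  let _ := atlasTopology dom φ
  rw [← univ_inter s, ← h.cover, iUnion_inter]
  refine isOpen_iUnion fun i => .basic _ ⟨i, _, hs i, ?_⟩
  ext x
  refine ⟨fun hx => ⟨hx.1, mem_image_of_mem _ hx⟩, fun ⟨hi, y, hy, hyx⟩ => ?_⟩
  exact h.injOn i hy.1 hi hyx ▸ hy

theorem SmoothOnAtlas.continuous {F : Type*} [NormedAddCommGroup F] [NormedSpace ℝ F] {f : M → F}
    (hf : SmoothOnAtlas dom φ f univ) (h : IsSmoothAtlas dom φ) :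
    Continuous[atlasTopology dom φ, inferInstance] f := by
  let _ := atlasTopology dom φ
  refine continuous_def.2 fun O hO => h.isOpen_iff.2 fun i => ?_
  have hfi : FactorsSmoothly (φ i) f (dom i) := .mono (hf i) (univ_inter _).ge
  exact hfi.isOpen_image_inter_preimage (inter_self (dom i) ▸ h.isOpen_image i i) hO

end AtlasTopology

/-! ### Graphs of operators from a subspace to its orthogonal complement -/

section Graph

variable {𝕜 H : Type*} [RCLike 𝕜] [NormedAddCommGroup H] [InnerProductSpace 𝕜 H]

section Projections

variable (W : Submodule 𝕜 H) [W.HasOrthogonalProjection]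

theorem comp_proj_add_comp_proj_orthogonal {E F : Type*} [NormedAddCommGroup E] [NormedSpace 𝕜 E]
    [NormedAddCommGroup F] [NormedSpace 𝕜 F] (A : H →L[𝕜] F) (B : E →L[𝕜] H) :
    (A ∘L W.subtypeL) ∘L (W.orthogonalProjectionOnto ∘L B) +
      (A ∘L Wᗮ.subtypeL) ∘L (Wᗮ.orthogonalProjectionOnto ∘L B) = A ∘L B := by
  ext x
  calc A (W.starProjection (B x)) + A (Wᗮ.starProjection (B x))
      = A (W.starProjection (B x) + Wᗮ.starProjection (B x)) := (map_add A _ _).symm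
    _ = A (B x) := by rw [W.starProjection_add_starProjection_orthogonal]

theorem proj_comp_subtypeL : W.orthogonalProjectionOnto ∘L W.subtypeL = .id 𝕜 W :=
  ContinuousLinearMap.ext W.orthogonalProjectionOnto_mem_subspace_eq_self

theorem proj_comp_subtypeL_orthogonal : W.orthogonalProjectionOnto ∘L Wᗮ.subtypeL = 0 :=
  Submodule.orthogonalProjectionOnto_comp_subtypeL_eq_zero_iff.2 W.isOrtho_orthogonal_right

theorem proj_orthogonal_comp_subtypeL : Wᗮ.orthogonalProjectionOnto ∘L W.subtypeL = 0 :=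
  Submodule.orthogonalProjectionOnto_comp_subtypeL_eq_zero_iff.2 W.isOrtho_orthogonal_left

end Projections

theorem isCompl_orthogonal_of_bijective_proj {W V : Submodule 𝕜 H} [W.HasOrthogonalProjection]
    (h : Function.Bijective (W.orthogonalProjectionOnto ∘L V.subtypeL)) : IsCompl V Wᗮ := by
  refine IsCompl.of_le (fun x ⟨hxV, hxW⟩ => ?_) fun x _ => ?_
  · have hx : W.orthogonalProjectionOnto x = 0 :=
      Submodule.orthogonalProjectionOnto_eq_zero_iff.2 hxW
    have : (⟨x, hxV⟩ : V) = 0 := h.injective (hx.trans (map_zero _).symm)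
    exact (Submodule.mk_eq_zero V hxV).1 this
  · obtain ⟨v, hv⟩ := h.surjective (W.orthogonalProjectionOnto x)
    refine Submodule.mem_sup.2 ⟨v, v.2, x - v, ?_, by abel⟩
    rw [← Submodule.orthogonalProjectionOnto_eq_zero_iff, map_sub, sub_eq_zero]
    exact hv.symm

theorem bijective_proj_of_isCompl_orthogonal {W V : Submodule 𝕜 H} [W.HasOrthogonalProjection]
    (h : IsCompl V Wᗮ) : Function.Bijective (W.orthogonalProjectionOnto ∘L V.subtypeL) := by
  refine ⟨(injective_iff_map_eq_zero _).2 fun v hv => ?_, fun w => ?_⟩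
  · have hvW : (v : H) ∈ Wᗮ := Submodule.orthogonalProjectionOnto_eq_zero_iff.1 hv
    exact Subtype.ext (Submodule.disjoint_def.1 h.disjoint v v.2 hvW)
  · have hw : (w : H) ∈ V ⊔ Wᗮ := h.sup_eq_top ▸ Submodule.mem_top
    obtain ⟨v, hv, y, hy, hvy⟩ := Submodule.mem_sup.1 hw
    refine ⟨⟨v, hv⟩, ?_⟩
    calc W.orthogonalProjectionOnto v = W.orthogonalProjectionOnto (v + y) := by
          rw [map_add, Submodule.orthogonalProjectionOnto_eq_zero_iff.2 hy, add_zero]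
      _ = w := by rw [hvy, W.orthogonalProjectionOnto_mem_subspace_eq_self]

theorem isInvertible_proj_comp_subtypeL_iff {W V : Submodule 𝕜 H} [CompleteSpace W]
    [CompleteSpace V] :
    (W.orthogonalProjectionOnto ∘L V.subtypeL).IsInvertible ↔ IsCompl V Wᗮ := by
  refine ⟨fun h => isCompl_orthogonal_of_bijective_proj h.bijective, fun h => ?_⟩
  obtain ⟨hinj, hsurj⟩ := bijective_proj_of_isCompl_orthogonal h
  exact ⟨.ofBijective _ (LinearMap.ker_eq_bot.2 hinj) (LinearMap.range_eq_top.2 hsurj),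
    ContinuousLinearEquiv.coe_ofBijective _ _ _⟩

section GraphMap

variable {W : Submodule 𝕜 H} (A : W →L[𝕜] Wᗮ)

/-- The map `x ↦ x + A x`, whose range is the graph of `A`. -/
def graphMap : W →L[𝕜] H := W.subtypeL + Wᗮ.subtypeL ∘L A

variable [W.HasOrthogonalProjection]

theorem proj_comp_graphMap : W.orthogonalProjectionOnto ∘L graphMap A = .id 𝕜 W := by
  rw [graphMap, ContinuousLinearMap.comp_add, ← ContinuousLinearMap.comp_assoc,
    proj_comp_subtypeL, proj_comp_subtypeL_orthogonal, ContinuousLinearMap.zero_comp, add_zero]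

theorem proj_orthogonal_comp_graphMap : Wᗮ.orthogonalProjectionOnto ∘L graphMap A = A := by
  rw [graphMap, ContinuousLinearMap.comp_add, ← ContinuousLinearMap.comp_assoc,
    proj_comp_subtypeL, proj_orthogonal_comp_subtypeL, ContinuousLinearMap.id_comp, zero_add]

/-- The graph of `A : W → Wᗮ` as a subspace of `H`, defined as a kernel so that it is closed. -/
def graphSpace : Submodule 𝕜 H :=
  (Wᗮ.orthogonalProjectionOnto - A ∘L W.orthogonalProjectionOnto).ker

theorem mem_graphSpace {A : W →L[𝕜] Wᗮ} {x : H} : x ∈ graphSpace A ↔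
    Wᗮ.orthogonalProjectionOnto x = A (W.orthogonalProjectionOnto x) := by
  simp [graphSpace, sub_eq_zero]

instance [CompleteSpace H] : CompleteSpace (graphSpace A) :=
  (Wᗮ.orthogonalProjectionOnto - A ∘L W.orthogonalProjectionOnto).isClosed_ker.completeSpace_coe

theorem graphMap_mem_graphSpace (x : W) : graphMap A x ∈ graphSpace A :=
  mem_graphSpace.2 <| calc
    Wᗮ.orthogonalProjectionOnto (graphMap A x) = A x :=
      DFunLike.congr_fun (proj_orthogonal_comp_graphMap A) x
    _ = A (W.orthogonalProjectionOnto (graphMap A x)) :=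
      congrArg A (DFunLike.congr_fun (proj_comp_graphMap A) x).symm

theorem graphMap_proj {A : W →L[𝕜] Wᗮ} {x : H} (hx : x ∈ graphSpace A) :
    graphMap A (W.orthogonalProjectionOnto x) = x := by
  simp [graphMap, ← mem_graphSpace.1 hx]

/-- The isomorphism of the graph of `A : W → Wᗮ` with `W`, given by the projection. -/
def graphEquiv : graphSpace A ≃L[𝕜] W :=
  .equivOfInverse' (W.orthogonalProjectionOnto ∘L (graphSpace A).subtypeL)
    ((graphMap A).codRestrict _ (graphMap_mem_graphSpace A))
    (by rw [ContinuousLinearMap.comp_assoc]; exact proj_comp_graphMap A)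
    (by ext x; exact graphMap_proj x.2)

theorem subtypeL_graphSpace :
    (graphSpace A).subtypeL = graphMap A ∘L (graphEquiv A : graphSpace A →L[𝕜] W) :=
  ContinuousLinearMap.ext fun x => (graphMap_proj x.2).symm

end GraphMap

end Graph

/-! ### The restricted Grassmannian as a manifold -/

theorem IsHilbertSchmidt.of_comp_isFredholm {E F G : Type*} [NormedAddCommGroup E]
    [InnerProductSpace ℂ E] [CompleteSpace E] [NormedAddCommGroup F] [InnerProductSpace ℂ F]
    [CompleteSpace F] [NormedAddCommGroup G] [InnerProductSpace ℂ G] [CompleteSpace G]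
    {A : F →L[ℂ] G} {T : E →L[ℂ] F} (hT : T.IsFredholm) (hAT : IsHilbertSchmidt (A ∘L T)) :
    IsHilbertSchmidt A := by
  obtain ⟨S, -, hS⟩ := hT.exists_isQuasiInverse
  have hK : IsHilbertSchmidt (T ∘L S - .id ℂ F) :=
    isHilbertSchmidt_of_hasFiniteRange (LinearMap.FiniteRangeSetoid.equiv_iff_hasFiniteRange.1 hS)
  have hA : A = (A ∘L T) ∘L S - A ∘L (T ∘L S - .id ℂ F) := by
    rw [ContinuousLinearMap.comp_sub, ContinuousLinearMap.comp_assoc, ContinuousLinearMap.comp_id,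
      sub_sub_cancel]
  rw [hA]
  exact (hAT.comp_clm S).sub (hK.clm_comp A)

section Grassmannian

variable {H : Type*} [NormedAddCommGroup H] [InnerProductSpace ℂ H]
  {Hp : Submodule ℂ H} [CompleteSpace Hp]

theorem GrRes.ext_starProjection {V W : GrRes Hp}
    (h : V.space.starProjection = W.space.starProjection) : V = W := by
  cases V
  cases W
  congr
  exact Submodule.starProjection_inj.1 h

theorem mem_grDom_iff {V W : GrRes Hp} : V ∈ grDom W ↔
    (W.space.orthogonalProjectionOnto ∘L V.space.subtypeL).IsInvertible :=
  isInvertible_proj_comp_subtypeL_iff.symm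

theorem mem_grDom_self (W : GrRes Hp) : W ∈ grDom W :=
  Submodule.isCompl_orthogonal _

section Charts

theorem grChartOp_comp_proj {V W : GrRes Hp} (h : V ∈ grDom W) :
    grChartOp W V ∘L (W.space.orthogonalProjectionOnto ∘L V.space.subtypeL) =
      W.spaceᗮ.orthogonalProjectionOnto ∘L V.space.subtypeL := by
  rw [grChartOp, ContinuousLinearMap.comp_assoc, (mem_grDom_iff.1 h).inverse_comp_self,
    ContinuousLinearMap.comp_id]

theorem graphMap_grChartOp_comp_proj {V W : GrRes Hp} (h : V ∈ grDom W) :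
    graphMap (grChartOp W V) ∘L (W.space.orthogonalProjectionOnto ∘L V.space.subtypeL) =
      V.space.subtypeL := by
  rw [graphMap, ContinuousLinearMap.add_comp, ContinuousLinearMap.comp_assoc,
    grChartOp_comp_proj h]
  simpa only [ContinuousLinearMap.id_comp] using
    comp_proj_add_comp_proj_orthogonal W.space (.id ℂ H) V.space.subtypeL

theorem range_graphMap_grChartOp {V W : GrRes Hp} (h : V ∈ grDom W) :
    (graphMap (grChartOp W V)).range = V.space := by
  have hsurj := (mem_grDom_iff.1 h).surjective
  calc (graphMap (grChartOp W V)).range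
      = (graphMap (grChartOp W V) ∘L
          (W.space.orthogonalProjectionOnto ∘L V.space.subtypeL)).range :=
        (LinearMap.range_comp_of_range_eq_top _ (LinearMap.range_eq_top.2 hsurj)).symm
    _ = V.space := by rw [graphMap_grChartOp_comp_proj h]; exact V.space.range_subtype

variable [CompleteSpace H]

namespace GrRes

theorem isHilbertSchmidt_proj_orthogonal_polarization (W : GrRes Hp) :
    IsHilbertSchmidt (W.spaceᗮ.orthogonalProjectionOnto ∘L Hp.subtypeL) := by
  have h := comp_proj_add_comp_proj_orthogonal Hp W.spaceᗮ.orthogonalProjectionOnto W.space.subtypeL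
  rw [proj_orthogonal_comp_subtypeL, add_eq_zero_iff_eq_neg] at h
  refine .of_comp_isFredholm W.fredholm ?_
  rw [h]
  exact (W.hilbertSchmidt.clm_comp _).neg

theorem isHilbertSchmidt_proj_orthogonal (V W : GrRes Hp) :
    IsHilbertSchmidt (W.spaceᗮ.orthogonalProjectionOnto ∘L V.space.subtypeL) := by
  rw [← comp_proj_add_comp_proj_orthogonal Hp]
  exact (W.isHilbertSchmidt_proj_orthogonal_polarization.comp_clm _).add
    (V.hilbertSchmidt.clm_comp _)

/-- The graph of a Hilbert–Schmidt operator `W → Wᗮ`, as a point of the restricted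
Grassmannian. -/
def graph (W : GrRes Hp) (A : HS W.space W.spaceᗮ) : GrRes Hp where
  space := graphSpace A.toCLM
  complete := inferInstance
  fredholm := by
    rw [subtypeL_graphSpace, ← ContinuousLinearMap.comp_assoc, graphMap,
      ContinuousLinearMap.comp_add, ← ContinuousLinearMap.comp_assoc]
    exact isFredholm_comp_equiv (isFredholm_add_of_mem_closure_hasFiniteRange W.fredholm
      (A.isHilbertSchmidt.clm_comp _).mem_closure_hasFiniteRange) _
  hilbertSchmidt := by
    rw [subtypeL_graphSpace, ← ContinuousLinearMap.comp_assoc, graphMap,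
      ContinuousLinearMap.comp_add, ← ContinuousLinearMap.comp_assoc]
    exact (W.hilbertSchmidt.add (A.isHilbertSchmidt.clm_comp _)).comp_clm _

end GrRes

theorem isHilbertSchmidt_grChartOp (W V : GrRes Hp) : IsHilbertSchmidt (grChartOp W V) :=
  (V.isHilbertSchmidt_proj_orthogonal W).comp_clm _

theorem toCLM_grChart (W V : GrRes Hp) : (grChart W V).toCLM = grChartOp W V := by
  rw [grChart, dif_pos (isHilbertSchmidt_grChartOp W V), HS.toCLM_mk]

theorem graph_mem_grDom (W : GrRes Hp) (A : HS W.space W.spaceᗮ) : W.graph A ∈ grDom W :=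
  mem_grDom_iff.2 ⟨graphEquiv A.toCLM, rfl⟩

theorem grChart_graph (W : GrRes Hp) (A : HS W.space W.spaceᗮ) : grChart W (W.graph A) = A := by
  ext1
  let e : graphSpace A.toCLM →L[ℂ] W.space := graphEquiv A.toCLM
  calc (grChart W (W.graph A)).toCLM
      = (W.spaceᗮ.orthogonalProjectionOnto ∘L (graphSpace A.toCLM).subtypeL) ∘L e.inverse :=
        toCLM_grChart _ _
    _ = A.toCLM ∘L e ∘L e.inverse := by
        rw [subtypeL_graphSpace, ← ContinuousLinearMap.comp_assoc, proj_orthogonal_comp_graphMap,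
          ContinuousLinearMap.comp_assoc]
    _ = A.toCLM := by
        rw [ContinuousLinearMap.inverse_equiv, ContinuousLinearEquiv.coe_comp_coe_symm,
          ContinuousLinearMap.comp_id]

theorem injOn_grChart (W : GrRes Hp) : InjOn (grChart W) (grDom W) := by
  intro V hV U hU h
  have hop : grChartOp W V = grChartOp W U := by rw [← toCLM_grChart, h, toCLM_grChart]
  have hspace : V.space = U.space := by
    rw [← range_graphMap_grChartOp hV, hop, range_graphMap_grChartOp hU]
  exact GrRes.ext_starProjection (Submodule.starProjection_inj.2 hspace)

end Charts

section Transitions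

/-- The operator `P_{W'} (1 + A) : W → W'`, which is invertible if and only if the graph of `A`
belongs to the domain of the chart at `W'`. -/
def grDenominator (W W' : GrRes Hp) (A : HS W.space W.spaceᗮ) : W.space →L[ℂ] W'.space :=
  W'.space.orthogonalProjectionOnto ∘L W.space.subtypeL +
    (W'.space.orthogonalProjectionOnto ∘L W.spaceᗮ.subtypeL) ∘L A.toCLM

theorem grDenominator_eq (W W' : GrRes Hp) (A : HS W.space W.spaceᗮ) :
    grDenominator W W' A = W'.space.orthogonalProjectionOnto ∘L graphMap A.toCLM := by
  rw [graphMap, ContinuousLinearMap.comp_add]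
  rfl

variable [CompleteSpace H]

/-- The operator `P_{W'ᗮ} (1 + A) : W → W'ᗮ`. -/
def grNumerator (W W' : GrRes Hp) (A : HS W.space W.spaceᗮ) : HS W.space W'.spaceᗮ :=
  HS.mk _ (W.isHilbertSchmidt_proj_orthogonal W') +
    HS.clmComp (W'.spaceᗮ.orthogonalProjectionOnto ∘L W.spaceᗮ.subtypeL) A

/-- The coordinate change from the chart at `W` to the chart at `W'`. -/
def grTransition (W W' : GrRes Hp) (A : HS W.space W.spaceᗮ) : HS W'.space W'.spaceᗮ :=
  HS.compCLM _ _ _ (grNumerator W W' A) (grDenominator W W' A).inverse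

theorem toCLM_grNumerator (W W' : GrRes Hp) (A : HS W.space W.spaceᗮ) :
    (grNumerator W W' A).toCLM = W'.spaceᗮ.orthogonalProjectionOnto ∘L graphMap A.toCLM := by
  rw [graphMap, ContinuousLinearMap.comp_add]
  rfl

theorem grDenominator_grChart_comp_proj {V W : GrRes Hp} (h : V ∈ grDom W) (W' : GrRes Hp) :
    grDenominator W W' (grChart W V) ∘L
      (W.space.orthogonalProjectionOnto ∘L V.space.subtypeL) =
      W'.space.orthogonalProjectionOnto ∘L V.space.subtypeL := by
  rw [grDenominator_eq, toCLM_grChart, ContinuousLinearMap.comp_assoc,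
    graphMap_grChartOp_comp_proj h]

theorem toCLM_grNumerator_grChart_comp_proj {V W : GrRes Hp} (h : V ∈ grDom W) (W' : GrRes Hp) :
    (grNumerator W W' (grChart W V)).toCLM ∘L
      (W.space.orthogonalProjectionOnto ∘L V.space.subtypeL) =
      W'.spaceᗮ.orthogonalProjectionOnto ∘L V.space.subtypeL := by
  rw [toCLM_grNumerator, toCLM_grChart, ContinuousLinearMap.comp_assoc,
    graphMap_grChartOp_comp_proj h]

theorem mem_grDom_iff_isInvertible_grDenominator {V W : GrRes Hp} (h : V ∈ grDom W)
    (W' : GrRes Hp) : V ∈ grDom W' ↔ (grDenominator W W' (grChart W V)).IsInvertible := by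
  obtain ⟨e, he⟩ := mem_grDom_iff.1 h
  rw [mem_grDom_iff, ← grDenominator_grChart_comp_proj h, ← he,
    ContinuousLinearMap.isInvertible_comp_equiv]

theorem grTransition_grChart {V W : GrRes Hp} (h : V ∈ grDom W) (W' : GrRes Hp) :
    grTransition W W' (grChart W V) = grChart W' V := by
  ext1
  have hP := mem_grDom_iff.1 h
  rw [toCLM_grChart, grTransition, HS.toCLM_compCLM, grChartOp,
    ← grDenominator_grChart_comp_proj h, ← toCLM_grNumerator_grChart_comp_proj h,
    hP.inverse_comp_of_right, ContinuousLinearMap.comp_assoc,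
    ← ContinuousLinearMap.comp_assoc (W.space.orthogonalProjectionOnto ∘L V.space.subtypeL),
    hP.self_comp_inverse, ContinuousLinearMap.id_comp]

theorem contDiff_grDenominator (W W' : GrRes Hp) : ContDiff ℂ ∞ (grDenominator W W') :=
  contDiff_const.add (contDiff_const.clm_comp (HS.toCLML W.space W.spaceᗮ).contDiff)

theorem isOpen_isInvertible_grDenominator (W W' : GrRes Hp) :
    IsOpen {A | (grDenominator W W' A).IsInvertible} :=
  (ContinuousLinearEquiv.isOpen (𝕜 := ℂ) (E := W.space) (F := W'.space)).preimage
    (contDiff_grDenominator W W').continuous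

theorem contDiffOn_grTransition (W W' : GrRes Hp) :
    ContDiffOn ℂ ∞ (grTransition W W') {A | (grDenominator W W' A).IsInvertible} := by
  intro A hA
  have hden : ContDiffAt ℂ ∞ (fun A => (grDenominator W W' A).inverse) A :=
    (ContinuousLinearMap.IsInvertible.contDiffAt_map_inverse hA).comp A
      (contDiff_grDenominator W W').contDiffAt
  have hnum : ContDiffAt ℂ ∞ (grNumerator W W') A :=
    contDiffAt_const.add (HS.clmComp _).contDiff.contDiffAt
  exact ((HS.compCLM _ _ _).isBoundedBilinearMap.contDiff.contDiffAt.comp A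
    (hnum.prodMk hden)).contDiffWithinAt

theorem image_grChart_inter_grDom (W W' : GrRes Hp) :
    grChart W '' (grDom W ∩ grDom W') = {A | (grDenominator W W' A).IsInvertible} := by
  ext A
  constructor
  · rintro ⟨V, ⟨hV, hV'⟩, rfl⟩
    exact (mem_grDom_iff_isInvertible_grDenominator hV W').1 hV'
  · intro hA
    refine ⟨W.graph A, ⟨graph_mem_grDom W A, ?_⟩, grChart_graph W A⟩
    rw [mem_grDom_iff_isInvertible_grDenominator (graph_mem_grDom W A), grChart_graph]
    exact hA

variable (Hp) in
theorem isSmoothAtlas_grChart :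
    IsSmoothAtlas (E := fun W : GrRes Hp => HS W.space W.spaceᗮ) grDom grChart where
  cover := iUnion_eq_univ_iff.2 fun W => ⟨W, mem_grDom_self W⟩
  injOn := injOn_grChart
  isOpen_image W W' := by
    rw [image_grChart_inter_grDom]
    exact isOpen_isInvertible_grDenominator W W'
  smooth_transition W W' := ⟨grTransition W W', by
    rw [image_grChart_inter_grDom]
    exact (contDiffOn_grTransition W W').restrict_scalars ℝ,
    fun V hV => grTransition_grChart hV.1 W'⟩

theorem isOpen_image_grChart {W : GrRes Hp} {Ω : Set (GrRes Hp)} (hΩ : IsOpen[grTopology Hp] Ω)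
    (h : Ω ⊆ grDom W) : IsOpen (grChart W '' Ω) := by
  rw [← inter_eq_self_of_subset_right h]
  exact (isSmoothAtlas_grChart Hp).isOpen_image_inter hΩ W

end Transitions

end Grassmannian

/-! ### Conjugation by unitary elements -/

section StarMul

variable {R : Type*} [Monoid R] [StarMul R] {a b p u : R}

theorem star_mul_mul_mul_star_mul_cancel (ha : a ∈ unitary R) (hb : b ∈ unitary R) (x : R) :
    star a * (a * x * star b) * b = x := by
  calc star a * (a * x * star b) * b = (star a * a) * x * (star b * b) := by simp only [mul_assoc]
    _ = x := by
      rw [Unitary.star_mul_self_of_mem ha, Unitary.star_mul_self_of_mem hb, one_mul, mul_one]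

theorem mul_star_mul_mul_mul_star_cancel (ha : a ∈ unitary R) (hb : b ∈ unitary R) (x : R) :
    a * (star a * x * b) * star b = x := by
  simpa only [star_star] using
    star_mul_mul_mul_star_mul_cancel (Unitary.star_mem ha) (Unitary.star_mem hb) x

theorem star_mul_self_star_mul_mul (ha : a ∈ unitary R) (hb : b ∈ unitary R)
    (h : b * p * star b = star u * u) : star (star a * u * b) * (star a * u * b) = p := by
  calc star (star a * u * b) * (star a * u * b) = star b * (star u * (a * star a) * u) * b := by
        simp only [star_mul, star_star, mul_assoc]
    _ = star b * (b * p * star b) * b := by rw [Unitary.mul_star_self_of_mem ha, mul_one, h]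
    _ = p := star_mul_mul_mul_star_mul_cancel hb hb p

theorem mul_star_self_star_mul_mul (ha : a ∈ unitary R) (hb : b ∈ unitary R)
    (h : a * p * star a = u * star u) : (star a * u * b) * star (star a * u * b) = p := by
  have := star_mul_self_star_mul_mul (u := star u) hb ha (by rwa [star_star])
  simpa only [star_mul, star_star, mul_assoc] using this

end StarMul

theorem mul_star_mul_self_of_isStarProjection {A : Type*} [NonUnitalNormedRing A] [StarRing A]
    [CStarRing A] {u : A} (h : IsStarProjection (star u * u)) : u * (star u * u) = u := by
  have hp : star u * u * (star u * u) = star u * u := h.isIdempotentElem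
  rw [← sub_eq_zero, ← CStarRing.star_mul_self_eq_zero_iff]
  calc star (u * (star u * u) - u) * (u * (star u * u) - u)
      = star u * u * (star u * u) * (star u * u) - star u * u * (star u * u) -
          (star u * u * (star u * u) - star u * u) := by
        simp only [star_sub, star_mul, star_star]
        noncomm_ring
    _ = 0 := by rw [hp, hp, sub_self]

/-! ### Compressions and dilations -/

section Compression

variable {𝕜 H : Type*} [RCLike 𝕜] [NormedAddCommGroup H] [InnerProductSpace 𝕜 H]
  (K : Submodule 𝕜 H)

section

variable [K.HasOrthogonalProjection]

/-- The compression `x ↦ P_K x|_K` of operators to a subspace `K`. -/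
def compress : (H →L[𝕜] H) →L[𝕜] (K →L[𝕜] K) :=
  (ContinuousLinearMap.compL 𝕜 K H K K.orthogonalProjectionOnto) ∘L
    ((ContinuousLinearMap.compL 𝕜 K H H).flip K.subtypeL)

/-- The extension by zero `T ↦ T P_K` of operators on a subspace `K`. -/
def dilate : (K →L[𝕜] K) →L[𝕜] (H →L[𝕜] H) :=
  (ContinuousLinearMap.compL 𝕜 H K H K.subtypeL) ∘L
    ((ContinuousLinearMap.compL 𝕜 H K K).flip K.orthogonalProjectionOnto)

theorem compress_apply (x : H →L[𝕜] H) :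
    compress K x = K.orthogonalProjectionOnto ∘L x ∘L K.subtypeL := rfl

theorem dilate_apply (T : K →L[𝕜] K) :
    dilate K T = K.subtypeL ∘L T ∘L K.orthogonalProjectionOnto := rfl

theorem compress_dilate (T : K →L[𝕜] K) : compress K (dilate K T) = T := by
  ext x
  simp [compress_apply, dilate_apply]

theorem dilate_compress (x : H →L[𝕜] H) :
    dilate K (compress K x) = K.starProjection * x * K.starProjection := rfl

theorem dilate_injective : Function.Injective (dilate K) :=
  Function.LeftInverse.injective (compress_dilate K)

theorem dilate_one : dilate K 1 = K.starProjection := rfl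

theorem dilate_mul (S T : K →L[𝕜] K) : dilate K (S * T) = dilate K S * dilate K T := by
  ext x
  simp [dilate_apply]

end

variable [CompleteSpace H] [CompleteSpace K]

theorem star_dilate (T : K →L[𝕜] K) : star (dilate K T) = dilate K (star T) := by
  simp only [dilate_apply, ContinuousLinearMap.star_eq_adjoint, ContinuousLinearMap.adjoint_comp,
    Submodule.adjoint_subtypeL, Submodule.adjoint_orthogonalProjectionOnto,
    ContinuousLinearMap.comp_assoc]

variable {K} {a b x : H →L[𝕜] H} {T : K →L[𝕜] K}

theorem dilate_compress_of_mul_eq_starProjection (hs : star x * x = K.starProjection)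
    (ht : x * star x = K.starProjection) : dilate K (compress K x) = x := by
  have hx : x * K.starProjection = x := by
    rw [← hs]
    exact mul_star_mul_self_of_isStarProjection (hs ▸ isStarProjection_starProjection)
  calc dilate K (compress K x) = K.starProjection * x * K.starProjection := dilate_compress K x
    _ = x * (star x * x) := by rw [mul_assoc, hx, ← ht, mul_assoc]
    _ = x := by rw [hs, hx]

theorem compress_mem_unitary (hs : star x * x = K.starProjection)
    (ht : x * star x = K.starProjection) : compress K x ∈ unitary (K →L[𝕜] K) := by
  have hx := dilate_compress_of_mul_eq_starProjection hs ht
  refine Unitary.mem_iff.2 ⟨dilate_injective K ?_, dilate_injective K ?_⟩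
  · rw [dilate_mul, ← star_dilate, hx, hs, dilate_one]
  · rw [dilate_mul, ← star_dilate, hx, ht, dilate_one]

theorem star_mul_self_mul_dilate_mul_star (ha : a ∈ unitary (H →L[𝕜] H))
    (hT : T ∈ unitary (K →L[𝕜] K)) :
    star (a * dilate K T * star b) * (a * dilate K T * star b) = b * K.starProjection * star b := by
  calc star (a * dilate K T * star b) * (a * dilate K T * star b)
      = b * (star (dilate K T) * (star a * a) * dilate K T) * star b := by
        simp only [star_mul, star_star, mul_assoc]
    _ = b * K.starProjection * star b := by
        rw [Unitary.star_mul_self_of_mem ha, mul_one, star_dilate, ← dilate_mul,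
          Unitary.star_mul_self_of_mem hT, dilate_one]

theorem mul_star_self_mul_dilate_mul_star (hb : b ∈ unitary (H →L[𝕜] H))
    (hT : T ∈ unitary (K →L[𝕜] K)) :
    (a * dilate K T * star b) * star (a * dilate K T * star b) = a * K.starProjection * star a := by
  have := star_mul_self_mul_dilate_mul_star (b := a) hb (Unitary.star_mem hT)
  simpa only [star_mul, star_star, star_dilate, mul_assoc] using this

theorem starProjection_of_map_eq (ha : a ∈ unitary (H →L[𝕜] H)) {V : Submodule 𝕜 H}
    [V.HasOrthogonalProjection] (h : K.map (a : H →ₗ[𝕜] H) = V) :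
    V.starProjection = a * K.starProjection * star a := by
  subst h
  ext x
  exact Submodule.starProjection_map_apply (Unitary.linearIsometryEquiv ⟨a, ha⟩) K x

end Compression

section Groupoid

variable {H : Type*} [NormedAddCommGroup H] [InnerProductSpace ℂ H] [CompleteSpace H]
  {Hp : Submodule ℂ H} [CompleteSpace Hp]

/-! ### Partial isometries in terms of cross-sections -/

section CrossSections

variable {Ωβ Ωγ : Set (GrRes Hp)} {σβ σγ : GrRes Hp → URes Hp}

theorem transportOp_eq_compress (σγ σβ : GrRes Hp → URes Hp) (u : PartIsoRes Hp) :
    transportOp σγ σβ u = compress Hp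
      (star (σγ u.target).toLRes.toCLM * u.1 * (σβ u.source).toLRes.toCLM) := rfl

theorem IsSmoothCrossSection.starProjection_eq (hβ : IsSmoothCrossSection Ωβ σβ) {V : GrRes Hp}
    (hV : V ∈ Ωβ) : V.space.starProjection =
      (σβ V).toLRes.toCLM * Hp.starProjection * star (σβ V).toLRes.toCLM :=
  starProjection_of_map_eq (σβ V).2 (hβ.map_eq V hV)

variable {u : PartIsoRes Hp}

theorem star_mul_self_star_mul_mul_crossSection (σγ : GrRes Hp → URes Hp)
    (hβ : IsSmoothCrossSection Ωβ σβ) (hs : u.source ∈ Ωβ) :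
    let x := star (σγ u.target).toLRes.toCLM * u.1 * (σβ u.source).toLRes.toCLM
    star x * x = Hp.starProjection :=
  star_mul_self_star_mul_mul (σγ u.target).2 (σβ u.source).2
    ((hβ.starProjection_eq hs).symm.trans u.starProjection_source)

theorem mul_star_self_star_mul_mul_crossSection (σβ : GrRes Hp → URes Hp)
    (hγ : IsSmoothCrossSection Ωγ σγ) (ht : u.target ∈ Ωγ) :
    let x := star (σγ u.target).toLRes.toCLM * u.1 * (σβ u.source).toLRes.toCLM
    x * star x = Hp.starProjection :=
  mul_star_self_star_mul_mul (σγ u.target).2 (σβ u.source).2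
    ((hγ.starProjection_eq ht).symm.trans u.starProjection_target)

theorem transportOp_mem_unitary (hβ : IsSmoothCrossSection Ωβ σβ)
    (hγ : IsSmoothCrossSection Ωγ σγ) (hs : u.source ∈ Ωβ) (ht : u.target ∈ Ωγ) :
    transportOp σγ σβ u ∈ unitary (Hp →L[ℂ] Hp) :=
  compress_mem_unitary (star_mul_self_star_mul_mul_crossSection σγ hβ hs)
    (mul_star_self_star_mul_mul_crossSection σβ hγ ht)

theorem coe_transport (hβ : IsSmoothCrossSection Ωβ σβ) (hγ : IsSmoothCrossSection Ωγ σγ)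
    (hs : u.source ∈ Ωβ) (ht : u.target ∈ Ωγ) :
    (transport σγ σβ u : Hp →L[ℂ] Hp) = transportOp σγ σβ u := by
  rw [transport, dif_pos (transportOp_mem_unitary hβ hγ hs ht)]

theorem mul_dilate_transport_mul_star (hβ : IsSmoothCrossSection Ωβ σβ)
    (hγ : IsSmoothCrossSection Ωγ σγ) (hs : u.source ∈ Ωβ) (ht : u.target ∈ Ωγ) :
    (σγ u.target).toLRes.toCLM * dilate Hp (transport σγ σβ u : Hp →L[ℂ] Hp) *
      star (σβ u.source).toLRes.toCLM = u.1 := by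
  rw [coe_transport hβ hγ hs ht, transportOp_eq_compress, dilate_compress_of_mul_eq_starProjection
    (star_mul_self_star_mul_mul_crossSection σγ hβ hs)
    (mul_star_self_star_mul_mul_crossSection σβ hγ ht)]
  exact mul_star_mul_mul_mul_star_cancel (σγ u.target).2 (σβ u.source).2 u.1

theorem exists_source_target_transport_eq (hβ : IsSmoothCrossSection Ωβ σβ)
    (hγ : IsSmoothCrossSection Ωγ σγ) {V V' : GrRes Hp} (hV : V ∈ Ωβ) (hV' : V' ∈ Ωγ)
    (T : UGroup Hp) :
    ∃ u : PartIsoRes Hp, u.source = V ∧ u.target = V' ∧ transport σγ σβ u = T := by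
  let x : H →L[ℂ] H := (σγ V').toLRes.toCLM * dilate Hp T * star (σβ V).toLRes.toCLM
  have hs : V.space.starProjection = star x * x :=
    (hβ.starProjection_eq hV).trans (star_mul_self_mul_dilate_mul_star (σγ V').2 T.2).symm
  have ht : V'.space.starProjection = x * star x :=
    (hγ.starProjection_eq hV').trans (mul_star_self_mul_dilate_mul_star (σβ V).2 T.2).symm
  let u : PartIsoRes Hp := ⟨x, hs ▸ isStarProjection_starProjection,
    ht ▸ isStarProjection_starProjection, ⟨V, hs⟩, ⟨V', ht⟩⟩
  have hus : u.source = V := GrRes.ext_starProjection (u.starProjection_source.trans hs.symm)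
  have hut : u.target = V' := GrRes.ext_starProjection (u.starProjection_target.trans ht.symm)
  refine ⟨u, hus, hut, Subtype.ext ?_⟩
  rw [coe_transport hβ hγ (hus ▸ hV) (hut ▸ hV'), transportOp_eq_compress, hus, hut]
  exact (congrArg (compress Hp)
    (star_mul_mul_mul_star_mul_cancel (σγ V').2 (σβ V).2 _)).trans (compress_dilate Hp T)

end CrossSections

/-! ### Smoothness of cross-sections and of charts of the unitary group -/

variable (Hp) in
/-- The inclusion of `L_res` into the bounded operators, as a continuous linear map. -/
def LRes.toCLML : LRes Hp →L[ℂ] H →L[ℂ] H :=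
  LinearMap.mkContinuous ⟨⟨LRes.toCLM, fun _ _ => rfl⟩, fun _ _ => rfl⟩ 1
    fun x => (le_max_left ‖x.toCLM‖ ‖x.comm‖).trans_eq (one_mul _).symm

theorem IsSmoothCrossSection.factorsSmoothly_toCLM {Ω : Set (GrRes Hp)}
    {σ : GrRes Hp → URes Hp} (h : IsSmoothCrossSection Ω σ) (W : GrRes Hp) :
    FactorsSmoothly (grChart W) (fun V => (σ V).toLRes.toCLM) (Ω ∩ grDom W) :=
  FactorsSmoothly.contDiff_comp (h.smooth W) ((LRes.toCLML Hp).restrictScalars ℝ).contDiff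

theorem IsSmoothUnitaryChart.factorsSmoothly {K : Type*} [NormedAddCommGroup K]
    [InnerProductSpace ℂ K] [CompleteSpace K] {e : OpenPartialHomeomorph (UGroup K) (UAlg K)}
    (he : IsSmoothUnitaryChart e) :
    FactorsSmoothly (fun g : UGroup K => (g : K →L[ℂ] K)) e e.source := by
  let f₀ : (K →L[ℂ] K) → UAlg K := Function.extend Subtype.val e 0
  have hf₀ (g : UGroup K) : f₀ g = e g := Subtype.val_injective.extend_apply e 0 g
  refine ⟨f₀, ?_, fun g _ => hf₀ g⟩
  rintro _ ⟨g, hg, rfl⟩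
  obtain ⟨N, hN, hgN, f, hf, hfe⟩ := he.smooth g hg
  refine ((hf.contDiffAt (hN.mem_nhds hgN)).contDiffWithinAt).congr_of_eventuallyEq ?_
    ((hf₀ g).trans (hfe g hg hgN).symm)
  filter_upwards [self_mem_nhdsWithin, mem_nhdsWithin_of_mem_nhds (hN.mem_nhds hgN)]
  rintro _ ⟨g', hg', rfl⟩ hgN'
  exact (hf₀ g').trans (hfe g' hg' hgN').symm

instance (K : Type*) [NormedAddCommGroup K] [InnerProductSpace ℂ K] [CompleteSpace K] :
    CompleteSpace (UAlg K) :=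
  have : IsClosed (skewAdjoint.submodule ℝ (K →L[ℂ] K) : Set (K →L[ℂ] K)) :=
    isClosed_eq (f := fun x : K →L[ℂ] K => star x) (g := fun x => -x) continuous_star continuous_neg
  this.completeSpace_coe

/-! ### The atlas of the groupoid of partial isometries -/

section ResAtlas

variable {I J : Type*} {ψ : I → OpenPartialHomeomorph (UGroup Hp) (UAlg Hp)} {W : J → GrRes Hp}
  {Ω : J → Set (GrRes Hp)} {σ : J → GrRes Hp → URes Hp}

theorem mem_resDom_iff (hσ : ∀ β, IsSmoothCrossSection (Ω β) (σ β)) {i : I × J × J}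
    {u : PartIsoRes Hp} : u ∈ resDom ψ Ω σ i ↔ u.source ∈ Ω i.2.1 ∧ u.target ∈ Ω i.2.2 ∧
      transport (σ i.2.2) (σ i.2.1) u ∈ (ψ i.1).source :=
  ⟨fun h => ⟨h.1, h.2.1, h.2.2.2⟩, fun h => ⟨h.1, h.2.1,
    transportOp_mem_unitary (hσ _) (hσ _) h.1 h.2.1, h.2.2⟩⟩

theorem iUnion_resDom (hψcover : ⋃ α, (ψ α).source = univ) (hΩcover : ⋃ β, Ω β = univ)
    (hσ : ∀ β, IsSmoothCrossSection (Ω β) (σ β)) : ⋃ i, resDom ψ Ω σ i = univ := by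
  refine iUnion_eq_univ_iff.2 fun u => ?_
  obtain ⟨β, hβ⟩ := iUnion_eq_univ_iff.1 hΩcover u.source
  obtain ⟨γ, hγ⟩ := iUnion_eq_univ_iff.1 hΩcover u.target
  obtain ⟨α, hα⟩ := iUnion_eq_univ_iff.1 hψcover (transport (σ γ) (σ β) u)
  exact ⟨(α, β, γ), (mem_resDom_iff hσ).2 ⟨hβ, hγ, hα⟩⟩

theorem injOn_resChart (hΩdom : ∀ β, Ω β ⊆ grDom (W β))
    (hσ : ∀ β, IsSmoothCrossSection (Ω β) (σ β)) (i : I × J × J) :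
    InjOn (resChart ψ W σ i) (resDom ψ Ω σ i) := by
  intro u hu v hv h
  obtain ⟨hus, hut, huT⟩ := (mem_resDom_iff hσ).1 hu
  obtain ⟨hvs, hvt, hvT⟩ := (mem_resDom_iff hσ).1 hv
  simp only [resChart, Prod.mk.injEq] at h
  have htarget : u.target = v.target := injOn_grChart _ (hΩdom _ hut) (hΩdom _ hvt) h.1
  have hsource : u.source = v.source := injOn_grChart _ (hΩdom _ hus) (hΩdom _ hvs) h.2.1
  have htransport := (ψ i.1).injOn huT hvT h.2.2
  apply Subtype.ext
  rw [← mul_dilate_transport_mul_star (hσ _) (hσ _) hus hut,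
    ← mul_dilate_transport_mul_star (hσ _) (hσ _) hvs hvt, htarget, hsource, htransport]

theorem image_resChart_inter (hσ : ∀ β, IsSmoothCrossSection (Ω β) (σ β)) (i : I × J × J)
    (S S' : Set (GrRes Hp)) :
    resChart ψ W σ i '' (resDom ψ Ω σ i ∩ {u | u.source ∈ S ∧ u.target ∈ S'}) =
      (grChart (W i.2.2) '' (Ω i.2.2 ∩ S')) ×ˢ (grChart (W i.2.1) '' (Ω i.2.1 ∩ S)) ×ˢ
        (ψ i.1).target := by
  ext ⟨A, B, X⟩
  constructor
  · rintro ⟨u, ⟨hu, hS, hS'⟩, h⟩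
    obtain ⟨hus, hut, huT⟩ := (mem_resDom_iff hσ).1 hu
    simp only [resChart, Prod.mk.injEq] at h
    obtain ⟨rfl, rfl, rfl⟩ := h
    exact ⟨⟨_, ⟨hut, hS'⟩, rfl⟩, ⟨_, ⟨hus, hS⟩, rfl⟩, (ψ i.1).map_source huT⟩
  · rintro ⟨⟨V', hV', hA⟩, ⟨V, hV, hB⟩, hX⟩
    obtain ⟨u, rfl, rfl, huT⟩ :=
      exists_source_target_transport_eq (hσ _) (hσ _) hV.1 hV'.1 ((ψ i.1).symm X)
    refine ⟨u, ⟨(mem_resDom_iff hσ).2 ⟨hV.1, hV'.1, huT ▸ (ψ i.1).map_target hX⟩, hV.2, hV'.2⟩, ?_⟩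
    simp only [resChart, huT, hA, hB, (ψ i.1).right_inv hX]

section Smoothness

variable {F : Type*} [NormedAddCommGroup F] [NormedSpace ℝ F] {f : GrRes Hp → F}
  {S : Set (GrRes Hp)} {i : I × J × J}

theorem factorsSmoothly_comp_source (hf : FactorsSmoothly (grChart (W i.2.1)) f S) :
    FactorsSmoothly (resChart ψ W σ i) (f ∘ PartIsoRes.source) (PartIsoRes.source ⁻¹' S) :=
  (FactorsSmoothly.of_contDiffOn contDiff_snd.fst.contDiffOn).trans
    (hf.comp_mapsTo (mapsTo_preimage PartIsoRes.source S))

theorem factorsSmoothly_comp_target (hf : FactorsSmoothly (grChart (W i.2.2)) f S) :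
    FactorsSmoothly (resChart ψ W σ i) (f ∘ PartIsoRes.target) (PartIsoRes.target ⁻¹' S) :=
  (FactorsSmoothly.of_contDiffOn contDiffOn_fst).trans
    (hf.comp_mapsTo (mapsTo_preimage PartIsoRes.target S))

theorem factorsSmoothly_transport (hψ : IsSmoothUnitaryChart (ψ i.1)) :
    FactorsSmoothly (resChart ψ W σ i)
      (fun u => (transport (σ i.2.2) (σ i.2.1) u : Hp →L[ℂ] Hp)) (resDom ψ Ω σ i) := by
  refine ⟨fun x => (ψ i.1).symm x.2.2, hψ.smooth_symm.comp contDiff_snd.snd.contDiffOn ?_,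
    fun u hu => congrArg Subtype.val ((ψ i.1).left_inv hu.2.2.2)⟩
  rintro _ ⟨u, hu, rfl⟩
  exact (ψ i.1).map_source hu.2.2.2

theorem factorsSmoothly_coe (hψ : IsSmoothUnitaryChart (ψ i.1))
    (hΩdom : ∀ β, Ω β ⊆ grDom (W β)) (hσ : ∀ β, IsSmoothCrossSection (Ω β) (σ β)) :
    FactorsSmoothly (resChart ψ W σ i) (fun u => u.1) (resDom ψ Ω σ i) := by
  have htarget := (factorsSmoothly_comp_target (ψ := ψ) (σ := σ) (i := i)
    ((hσ i.2.2).factorsSmoothly_toCLM (W i.2.2))).mono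
      fun u (hu : u ∈ resDom ψ Ω σ i) => ⟨hu.2.1, hΩdom _ hu.2.1⟩
  have hsource := (factorsSmoothly_comp_source (ψ := ψ) (σ := σ) (i := i)
    ((hσ i.2.1).factorsSmoothly_toCLM (W i.2.1))).mono
      fun u (hu : u ∈ resDom ψ Ω σ i) => ⟨hu.1, hΩdom _ hu.1⟩
  have hdilate := (factorsSmoothly_transport (W := W) (Ω := Ω) (σ := σ) hψ).contDiff_comp
    ((dilate Hp).contDiff.restrict_scalars ℝ)
  exact ((htarget.mul hdilate).mul (hsource.contDiff_comp
    (starL' ℝ : (H →L[ℂ] H) ≃L[ℝ] (H →L[ℂ] H)).contDiff)).congr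
      fun u hu => mul_dilate_transport_mul_star (hσ _) (hσ _) hu.1 hu.2.1

theorem factorsSmoothly_transportOp (hψ : IsSmoothUnitaryChart (ψ i.1))
    (hΩdom : ∀ β, Ω β ⊆ grDom (W β)) (hσ : ∀ β, IsSmoothCrossSection (Ω β) (σ β)) (β γ : J) :
    FactorsSmoothly (resChart ψ W σ i) (transportOp (σ γ) (σ β))
      (resDom ψ Ω σ i ∩ {u | u.source ∈ Ω β ∧ u.target ∈ Ω γ}) := by
  set s := resDom ψ Ω σ i ∩ {u | u.source ∈ Ω β ∧ u.target ∈ Ω γ}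
  have htarget := (factorsSmoothly_comp_target (ψ := ψ) (σ := σ) (i := i)
    ((hσ γ).factorsSmoothly_toCLM (W i.2.2))).mono
      fun u (hu : u ∈ s) => ⟨hu.2.2, hΩdom _ hu.1.2.1⟩
  have hsource := (factorsSmoothly_comp_source (ψ := ψ) (σ := σ) (i := i)
    ((hσ β).factorsSmoothly_toCLM (W i.2.1))).mono
      fun u (hu : u ∈ s) => ⟨hu.2.1, hΩdom _ hu.1.1⟩
  have hcoe := (factorsSmoothly_coe hψ hΩdom hσ).mono fun u (hu : u ∈ s) => hu.1
  have hcompress : ContDiff ℂ ∞ (compress Hp) :=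
    ContinuousLinearMap.contDiff (E := H →L[ℂ] H) (F := Hp →L[ℂ] Hp) _
  exact (((htarget.contDiff_comp (starL' ℝ : (H →L[ℂ] H) ≃L[ℝ] (H →L[ℂ] H)).contDiff).mul
    hcoe).mul hsource).contDiff_comp (hcompress.restrict_scalars ℝ)

end Smoothness

theorem resDom_inter_subset (i j : I × J × J) : resDom ψ Ω σ i ∩ resDom ψ Ω σ j ⊆
    resDom ψ Ω σ i ∩ {u | u.source ∈ Ω j.2.1 ∧ u.target ∈ Ω j.2.2} :=
  fun _ hu => ⟨hu.1, hu.2.1, hu.2.2.1⟩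

theorem factorsSmoothly_resChart (hψ : ∀ α, IsSmoothUnitaryChart (ψ α))
    (hΩdom : ∀ β, Ω β ⊆ grDom (W β)) (hσ : ∀ β, IsSmoothCrossSection (Ω β) (σ β))
    (i j : I × J × J) : FactorsSmoothly (resChart ψ W σ i) (resChart ψ W σ j)
      (resDom ψ Ω σ i ∩ resDom ψ Ω σ j) := by
  set s := resDom ψ Ω σ i ∩ resDom ψ Ω σ j
  have hgr := (isSmoothAtlas_grChart Hp).smooth_transition
  have htarget := (factorsSmoothly_comp_target (ψ := ψ) (σ := σ) (hgr (W i.2.2) (W j.2.2))).mono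
    fun u (hu : u ∈ s) => ⟨hΩdom _ hu.1.2.1, hΩdom _ hu.2.2.1⟩
  have hsource := (factorsSmoothly_comp_source (ψ := ψ) (σ := σ) (hgr (W i.2.1) (W j.2.1))).mono
    fun u (hu : u ∈ s) => ⟨hΩdom _ hu.1.1, hΩdom _ hu.2.1⟩
  have htransport : FactorsSmoothly (resChart ψ W σ i)
      (fun u => (transport (σ j.2.2) (σ j.2.1) u : Hp →L[ℂ] Hp)) s :=
    ((factorsSmoothly_transportOp (hψ i.1) hΩdom hσ j.2.1 j.2.2).mono
      (resDom_inter_subset i j)).congr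
        fun u hu => (coe_transport (hσ _) (hσ _) hu.2.1 hu.2.2.1).symm
  exact htarget.prodMk (hsource.prodMk (htransport.trans
    ((hψ j.1).factorsSmoothly.comp_mapsTo fun u hu => hu.2.2.2.2)))

theorem isOpen_image_resChart_source_target (hΩopen : ∀ β, IsOpen[grTopology Hp] (Ω β))
    (hΩdom : ∀ β, Ω β ⊆ grDom (W β)) (hσ : ∀ β, IsSmoothCrossSection (Ω β) (σ β))
    (i : I × J × J) (β γ : J) : IsOpen (resChart ψ W σ i ''
      (resDom ψ Ω σ i ∩ {u | u.source ∈ Ω β ∧ u.target ∈ Ω γ})) := by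
  let _ := grTopology Hp
  have hinter (δ ε : J) : IsOpen (grChart (W δ) '' (Ω δ ∩ Ω ε)) :=
    isOpen_image_grChart ((hΩopen δ).inter (hΩopen ε)) (inter_subset_left.trans (hΩdom δ))
  rw [image_resChart_inter hσ]
  exact (hinter _ _).prod ((hinter _ _).prod (ψ i.1).open_target)

theorem isOpen_image_resChart_inter (hψ : ∀ α, IsSmoothUnitaryChart (ψ α))
    (hΩopen : ∀ β, IsOpen[grTopology Hp] (Ω β)) (hΩdom : ∀ β, Ω β ⊆ grDom (W β))
    (hσ : ∀ β, IsSmoothCrossSection (Ω β) (σ β)) (i j : I × J × J) :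
    IsOpen (resChart ψ W σ i '' (resDom ψ Ω σ i ∩ resDom ψ Ω σ j)) := by
  obtain ⟨O, hO, hOj⟩ := isOpen_induced_iff.1 (ψ j.1).open_source
  convert! (factorsSmoothly_transportOp (hψ i.1) hΩdom hσ j.2.1 j.2.2).isOpen_image_inter_preimage
    (isOpen_image_resChart_source_target hΩopen hΩdom hσ i j.2.1 j.2.2) hO using 2
  ext u
  rw [inter_assoc]
  refine and_congr_right fun _ => ?_
  rw [mem_resDom_iff hσ, ← and_assoc]
  refine and_congr_right fun hu => ?_
  rw [← hOj, mem_preimage, mem_preimage, coe_transport (hσ _) (hσ _) hu.1 hu.2]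

theorem isSmoothAtlas_resChart (hψ : ∀ α, IsSmoothUnitaryChart (ψ α))
    (hψcover : ⋃ α, (ψ α).source = univ) (hΩopen : ∀ β, IsOpen[grTopology Hp] (Ω β))
    (hΩdom : ∀ β, Ω β ⊆ grDom (W β)) (hΩcover : ⋃ β, Ω β = univ)
    (hσ : ∀ β, IsSmoothCrossSection (Ω β) (σ β)) :
    IsSmoothAtlas (E := fun i : I × J × J => resModel W i.2.1 i.2.2)
      (resDom ψ Ω σ) (resChart ψ W σ) where
  cover := iUnion_resDom hψcover hΩcover hσ
  injOn := injOn_resChart hΩdom hσ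
  isOpen_image := isOpen_image_resChart_inter hψ hΩopen hΩdom hσ
  smooth_transition := factorsSmoothly_resChart hψ hΩdom hσ

theorem smoothOnAtlas_coe (hψ : ∀ α, IsSmoothUnitaryChart (ψ α))
    (hΩdom : ∀ β, Ω β ⊆ grDom (W β)) (hσ : ∀ β, IsSmoothCrossSection (Ω β) (σ β)) :
    SmoothOnAtlas (E := fun i : I × J × J => resModel W i.2.1 i.2.2) (resDom ψ Ω σ)
      (resChart ψ W σ) (fun u => u.1) univ :=
  fun i => (factorsSmoothly_coe (hψ i.1) hΩdom hσ).mono inter_subset_right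

end ResAtlas

end Groupoid

end

theorem theorem5p3_general {H : Type*} [NormedAddCommGroup H] [InnerProductSpace ℂ H]
    [CompleteSpace H] (Hp : Submodule ℂ H) [CompleteSpace Hp]
    {I J : Type*}
    (ψ : I → OpenPartialHomeomorph (UGroup Hp) (UAlg Hp))
    (hψ : ∀ α, IsSmoothUnitaryChart (ψ α))
    (hψcover : ⋃ α, (ψ α).source = univ)
    (W : J → GrRes Hp) (Ω : J → Set (GrRes Hp)) (σ : J → GrRes Hp → URes Hp)
    (hΩopen : ∀ β, IsOpen[grTopology Hp] (Ω β))
    (hΩdom : ∀ β, Ω β ⊆ grDom (W β))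
    (hΩcover : ⋃ β, Ω β = univ)
    (hσ : ∀ β, IsSmoothCrossSection (Ω β) (σ β)) :
    (∀ β, ∀ V ∈ Ω β, IsHilbertSchmidt (grChartOp (W β) V)) ∧
    (∀ β γ, ∀ u : PartIsoRes Hp, u.source ∈ Ω β → u.target ∈ Ω γ →
      transportOp (σ γ) (σ β) u ∈ unitary (Hp →L[ℂ] Hp)) ∧
    IsSmoothAtlas (E := fun i : I × J × J => resModel W i.2.1 i.2.2)
      (resDom ψ Ω σ) (resChart ψ W σ) ∧
    (∀ β γ, CompleteSpace (resModel W β γ)) ∧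
    @T2Space (PartIsoRes Hp) (atlasTopology (E := fun i : I × J × J => resModel W i.2.1 i.2.2)
      (resDom ψ Ω σ) (resChart ψ W σ)) := by
  have hatlas := isSmoothAtlas_resChart hψ hψcover hΩopen hΩdom hΩcover hσ
  refine ⟨fun β V _ => isHilbertSchmidt_grChartOp (W β) V,
    fun β γ u hs ht => transportOp_mem_unitary (hσ β) (hσ γ) hs ht, hatlas,
    fun β γ => inferInstance, ?_⟩
  let _ := atlasTopology (E := fun i : I × J × J => resModel W i.2.1 i.2.2)
    (resDom ψ Ω σ) (resChart ψ W σ)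
  have hcoe : Continuous (fun u : PartIsoRes Hp => u.1) :=
    (smoothOnAtlas_coe hψ hΩdom hσ).continuous hatlas
  exact T2Space.of_injective_continuous Subtype.val_injective hcoe

theorem theorem5p3 {H : Type*} [NormedAddCommGroup H] [InnerProductSpace ℂ H] [CompleteSpace H]
    (Hp : Submodule ℂ H) [CompleteSpace Hp]
    (hHp : ¬ FiniteDimensional ℂ Hp) (hHm : ¬ FiniteDimensional ℂ Hpᗮ)
    {I J : Type*}
    -- a smooth atlas `(V_α, ψ_α)` of the unitary group of `Hp`
    (ψ : I → OpenPartialHomeomorph (UGroup Hp) (UAlg Hp))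
    (hψ : ∀ α, IsSmoothUnitaryChart (ψ α))
    (hψcover : ⋃ α, (ψ α).source = Set.univ)
    -- a family of smooth cross-sections over open sets `Ω_β`, contained in chart domains,
    -- that cover the restricted Grassmannian
    (W : J → GrRes Hp) (Ω : J → Set (GrRes Hp)) (σ : J → GrRes Hp → URes Hp)
    (hΩopen : ∀ β, IsOpen[grTopology Hp] (Ω β))
    (hWΩ : ∀ β, W β ∈ Ω β)
    (hΩdom : ∀ β, Ω β ⊆ grDom (W β))
    (hΩcover : ⋃ β, Ω β = Set.univ)
    (hσ : ∀ β, IsSmoothCrossSection (Ω β) (σ β)) :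
    -- the maps `Φ_{αβγ}` are well defined
    (∀ β, ∀ V ∈ Ω β, IsHilbertSchmidt (grChartOp (W β) V)) ∧
    (∀ β γ, ∀ u : PartIsoRes Hp, u.source ∈ Ω β → u.target ∈ Ω γ →
      transportOp (σ γ) (σ β) u ∈ unitary (Hp →L[ℂ] Hp)) ∧
    -- they form a smooth atlas
    IsSmoothAtlas (E := fun i : I × J × J => resModel W i.2.1 i.2.2)
      (resDom ψ Ω σ) (resChart ψ W σ) ∧
    -- the model spaces are Banach spaces, and the manifold is Hausdorff
    (∀ β γ, CompleteSpace (resModel W β γ)) ∧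
    @T2Space (PartIsoRes Hp) (atlasTopology (E := fun i : I × J × J => resModel W i.2.1 i.2.2)
      (resDom ψ Ω σ) (resChart ψ W σ)) :=
  theorem5p3_general Hp ψ hψ hψcover W Ω σ hΩopen hΩdom hΩcover hσ
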